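/- A \emph{scaled simplicial set} is a simplicial set with a set of 2-simplices (\emph{thin} triangles) containing all degenerate ones; maps preserve thin triangles. The \emph{scaled anodyne} maps are the smallest class of maps of scaled simplicial sets that is closed under cobase change, transfinite composition and retracts and contains (listing only non-degenerate thin triangles): (i) $(\Lambda^n_i,\{\Delta^{\{i-1,i,i+1\}}\})\to(\Delta^n,\{\Delta^{\{i-1,i,i+1\}}\})$ for $n\ge 2$, $0<i<n$ (on the left, the triangle is thin if it lies in the horn); (ii) $(\Delta^4,T)\to(\Delta^4,T\cup\{\Delta^{\{0,3,4\}},\Delta^{\{0,1,4\}}\})$ with $T=\{\Delta^{\{0,2,4\}},\Delta^{\{1,2,3\}},\Delta^{\{0,1,3\}},\Delta^{\{1,3,4\}},\Delta^{\{0,1,2\}}\}$; (iii) $(\Lambda^n_0\amalg_{\Delta^{\{0,1\}}}\Delta^0,\{\Delta^{\{0,1,n\}}\})\to(\Delta^n\amalg_{\Delta^{\{0,1\}}}\Delta^0,\{\Delta^{\{0,1,n\}}\})$ for $n\ge 3$. An \emph{$\infty$-bicategory} is a scaled simplicial set with the extension property with respect to scaled anodyne maps; a \emph{weak $\mathbf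 S$-fibration} is a map with the right lifting property with respect to scaled anodyne maps. For vertices $a,b$ of $X$, the mapping $\infty$-category $X(a,b)$ is the simplicial set whose $n$-simplices are the maps $\Delta^0\amalg_{\Delta^n}(\Delta^n\star\Delta^0)\to X$ sending the first vertex to $a$ and the second to $b$, i.e. the $(n+1)$-simplices of $X$ whose restriction to $\Delta^{\{0,\dots,n\}}$ is constant at $a$ and whose last vertex is $b$. A map $p:X\to S$ induces $p_{a,b}:X(a,b)\to S(p(a),p(b))$. A 2-simplex $\sigma$ of $X$ is \emph{left-degenerate} if $\sigma|_{\Delta^{\{0,1\}}}$ is degenerate; such a $\sigma$ with $\sigma(0)=a$ and $\sigma(2)=b$ is an edge of $X(a,b)$. \textbf{Proposition.} Let $X$ and $S$ be $\infty$-bicategories and let $p:X\to S$ be a weak $\mathbf S$-fibration. Let $\sigma:\Delta^2\to X$ be a left-degenerate triangle with $\sigma(0)=a$ and $\sigma(2)=b$. Then the following are equivalent: (1) $\sigma$ is $p$-coCartesian: for every $n\ge 3$, every commutative square of simplicial sets given by $f:\Lambda^n_0\to X$ and $g:\Delta^n\to S$ over $\Lambda^n_0\subset\Delta^n$ and $p$,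 with $f|_{\Delta^{\{0,1,n\}}}=\sigma$, admits a diagonal filler $\Delta^n\to X$; (2) $\sigma$ defines a $p_{a,b}$-coCartesian edge of $X(a,b)$: for every $n\ge 2$, every commutative square of simplicial sets given by $f:\Lambda^n_0\to X(a,b)$ and $g:\Delta^n\to S(p(a),p(b))$ over $\Lambda^n_0\subset\Delta^n$ and $p_{a,b}$, with $f|_{\Delta^{\{0,1\}}}$ equal to the edge defined by $\sigma$, admits a diagonal filler $\Delta^n\to X(a,b)$. -/

import Mathlib

open CategoryTheory Simplicial Opposite Limits

universe u

/-- A scaled simplicial set: a simplicial set together with a set of 2-simplices (the thin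
triangles) which contains all degenerate 2-simplices. -/
structure ScaledSSet : Type (u + 1) where
  /-- the underlying simplicial set -/
  toSSet : SSet.{u}
  /-- the thin triangles -/
  thin : Set (toSSet _⦋2⦌)
  degenerate_subset_thin : toSSet.degenerate 2 ⊆ thin

namespace ScaledSSet

/-- A map of scaled simplicial sets: a map of simplicial sets preserving thin triangles. -/
@[ext]
structure Hom (X Y : ScaledSSet.{u}) : Type u where
  /-- the underlying map of simplicial sets -/
  toHom : X.toSSet ⟶ Y.toSSet
  map_thin : ∀ t ∈ X.thin, toHom.app (op ⦋2⦌) t ∈ Y.thin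

instance : Category.{u} ScaledSSet.{u} where
  Hom := Hom
  id X := { toHom := 𝟙 X.toSSet, map_thin := fun _ ht => ht }
  comp f g :=
    { toHom := f.toHom ≫ g.toHom
      map_thin := fun t ht => g.map_thin _ (f.map_thin t ht) }

/-- The scaled simplicial set `(Y, T)`: the thin triangles are those in `T`, together with all
degenerate ones. -/
def ofTriangles (Y : SSet.{u}) (T : Set (Y _⦋2⦌)) : ScaledSSet.{u} where
  toSSet := Y
  thin := T ∪ Y.degenerate 2
  degenerate_subset_thin := Set.subset_union_right

/-- A map of simplicial sets carrying `T` into `U` is a map `(Y, T) ⟶ (Z, U)`. -/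
def ofTrianglesMap {Y Z : SSet.{u}} (f : Y ⟶ Z) (T : Set (Y _⦋2⦌)) (U : Set (Z _⦋2⦌))
    (h : ∀ t ∈ T, f.app (op ⦋2⦌) t ∈ U) : ofTriangles Y T ⟶ ofTriangles Z U :=
  { toHom := f
    map_thin := by
      rintro t (ht | ht)
      · exact Or.inl (h t ht)
      · exact Or.inr (SSet.degenerate_le_preimage f 2 ht) }

/-- The inclusion of a simplicial subset `A ⊆ Y`, whose thin triangles are the triangles of `A`
that lie in `T` (and the degenerate ones), into `(Y, T)`. -/
def subcomplexInclusion {Y : SSet.{u}} (A : Y.Subcomplex) (T : Set (Y _⦋2⦌)) :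
    ofTriangles (A : SSet.{u}) {t | A.ι.app (op ⦋2⦌) t ∈ T} ⟶ ofTriangles Y T :=
  ofTrianglesMap A.ι _ T fun _ ht => ht

/-- The simplicial set `Y ⨿_{Δ^1} Δ^0` obtained from `Y` by collapsing the edge `e` to a point. -/
noncomputable def collapse (Y : SSet.{u}) (e : Y _⦋1⦌) : SSet.{u} :=
  pushout (SSet.yonedaEquiv.symm e : Δ[1] ⟶ Y)
    (SSet.stdSimplex.map (SimplexCategory.σ 0) : (Δ[1] : SSet.{u}) ⟶ Δ[0])

/-- The quotient map `Y ⟶ Y ⨿_{Δ^1} Δ^0`. -/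
noncomputable def collapseMk (Y : SSet.{u}) (e : Y _⦋1⦌) : Y ⟶ collapse Y e :=
  pushout.inl _ _

/-- The map `Y ⨿_{Δ^1} Δ^0 ⟶ Z ⨿_{Δ^1} Δ^0` induced by a map `f : Y ⟶ Z` sending `e` to `e'`. -/
noncomputable def collapseMap {Y Z : SSet.{u}} (f : Y ⟶ Z) (e : Y _⦋1⦌) (e' : Z _⦋1⦌)
    (h : f.app (op ⦋1⦌) e = e') : collapse Y e ⟶ collapse Z e' :=
  pushout.map _ _ _ _ f (𝟙 _) (𝟙 _)
    (by rw [SSet.yonedaEquiv_symm_comp, h, Category.id_comp])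
    (by rw [Category.comp_id, Category.id_comp])

theorem collapseMk_map {Y Z : SSet.{u}} (f : Y ⟶ Z) (e : Y _⦋1⦌) (e' : Z _⦋1⦌)
    (h : f.app (op ⦋1⦌) e = e') :
    collapseMk Y e ≫ collapseMap f e e' h = f ≫ collapseMk Z e' :=
  pushout.inl_desc _ _ _

end ScaledSSet

namespace SSet

/-- The edge `Δ^{0,1}` of the horn `Λ^n_0` (here `n` is written as `n + 2`). -/
def hornEdge (n : ℕ) : (Λ[n + 2, 0] : SSet.{u}) _⦋1⦌ :=
  ⟨stdSimplex.edge (n + 2) 0 1 (Fin.zero_le _), by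
    rw [mem_horn_iff_notMem_range]
    refine ⟨Fin.last (n + 2), (Fin.last_pos).ne', ?_⟩
    rintro ⟨j, hj⟩
    fin_cases j
    · exact absurd (congrArg Fin.val hj) (by simp [stdSimplex.edge])
    · exact absurd (congrArg Fin.val hj) (by simp [stdSimplex.edge])⟩

/-- The triangle `Δ^{0,1,n}` of `Δ^n` (here `n` is written as `n + 3`). -/
def outerTriangle (n : ℕ) : (Δ[n + 3] : SSet.{u}) _⦋2⦌ :=
  stdSimplex.triangle 0 1 (Fin.last (n + 3)) (Fin.zero_le _) (Fin.le_last _)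

/-- The triangle `Δ^{0,1,n}` of the horn `Λ^n_0` (here `n` is written as `n + 3`). -/
def hornTriangle (n : ℕ) : (Λ[n + 3, 0] : SSet.{u}) _⦋2⦌ :=
  ⟨outerTriangle n, by
    rw [mem_horn_iff_notMem_range]
    refine ⟨⟨2, by lia⟩, ?_, ?_⟩
    · exact fun h => absurd (congrArg Fin.val h) (by simp)
    rintro ⟨j, hj⟩
    fin_cases j
    · exact absurd (congrArg Fin.val hj) (by simp [outerTriangle, stdSimplex.triangle])
    · exact absurd (congrArg Fin.val hj) (by simp [outerTriangle, stdSimplex.triangle])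
    · exact absurd (congrArg Fin.val hj) (by simp [outerTriangle, stdSimplex.triangle])⟩

end SSet

namespace ScaledSSet

/-- The triangles `{0,2,4}, {1,2,3}, {0,1,3}, {1,3,4}, {0,1,2}` of `Δ^4`. -/
def saturationSource : Set ((Δ[4] : SSet.{u}) _⦋2⦌) :=
  {SSet.stdSimplex.triangle 0 2 4 (by decide) (by decide),
    SSet.stdSimplex.triangle 1 2 3 (by decide) (by decide),
    SSet.stdSimplex.triangle 0 1 3 (by decide) (by decide),
    SSet.stdSimplex.triangle 1 3 4 (by decide) (by decide),
    SSet.stdSimplex.triangle 0 1 2 (by decide) (by decide)}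

/-- The triangles of `saturationSource` together with `{0,3,4}` and `{0,1,4}`. -/
def saturationTarget : Set ((Δ[4] : SSet.{u}) _⦋2⦌) :=
  saturationSource ∪
    {SSet.stdSimplex.triangle 0 3 4 (by decide) (by decide),
      SSet.stdSimplex.triangle 0 1 4 (by decide) (by decide)}

/-- The map `Λ^n_0 ⨿_{Δ^{0,1}} Δ^0 ⟶ Δ^n ⨿_{Δ^{0,1}} Δ^0`, where in both sides the image of
`Δ^{0,1,n}` is thin (here `n` is written as `n + 3`). -/
noncomputable def outerHornMap (n : ℕ) :
    ofTriangles (collapse (Λ[n + 3, 0] : SSet.{u}) (SSet.hornEdge (n + 1)))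
        {(collapseMk _ _).app (op ⦋2⦌) (SSet.hornTriangle n)} ⟶
      ofTriangles (collapse (Δ[n + 3] : SSet.{u})
          (SSet.stdSimplex.edge (n + 3) 0 1 (Fin.zero_le _)))
        {(collapseMk _ _).app (op ⦋2⦌) (SSet.outerTriangle n)} :=
  ofTrianglesMap (collapseMap (Λ[n + 3, 0] : (Δ[n + 3] : SSet.{u}).Subcomplex).ι _ _ rfl) _ _ (by
    rintro t rfl
    exact congrArg (fun g => g.app (op ⦋2⦌) (SSet.hornTriangle n))
      (collapseMk_map (Λ[n + 3, 0] : (Δ[n + 3] : SSet.{u}).Subcomplex).ι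
        (SSet.hornEdge (n + 1)) _ rfl))

/-- The generating scaled anodyne maps. -/
inductive generatingScaledAnodyne : MorphismProperty ScaledSSet.{u}
  /-- `(Λ^m_k, {Δ^{k-1,k,k+1}}) ⟶ (Δ^m, {Δ^{k-1,k,k+1}})` for `m ≥ 2` and `0 < k < m`, with
  `m = n + 2` and `k = i + 1`. -/
  | inner (n : ℕ) (i : Fin (n + 1)) :
      generatingScaledAnodyne
        (subcomplexInclusion (Λ[n + 2, i.castSucc.succ] : (Δ[n + 2] : SSet.{u}).Subcomplex)
          {SSet.stdSimplex.triangle i.castSucc.castSucc i.castSucc.succ i.succ.succ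
            (Fin.castSucc_le_succ _) (Fin.succ_le_succ_iff.2 (Fin.castSucc_le_succ _))})
  /-- the saturation map on `Δ^4` -/
  | saturation :
      generatingScaledAnodyne
        (ofTrianglesMap (𝟙 (Δ[4] : SSet.{u})) saturationSource saturationTarget
          fun _ ht => Or.inl ht)
  /-- the outer horns with collapsed edge `Δ^{0,1}`, in dimension `n + 3` -/
  | outer (n : ℕ) : generatingScaledAnodyne (outerHornMap n)

/-- A class of maps is weakly saturated if it is closed under cobase change, transfinite
composition and retracts. -/
structure IsWeaklySaturated (W : MorphismProperty ScaledSSet.{u}) : Prop where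
  cobaseChange : W.IsStableUnderCobaseChange
  transfiniteComposition : MorphismProperty.IsStableUnderTransfiniteComposition.{u} W
  retracts : W.IsStableUnderRetracts

/-- The scaled anodyne maps: the smallest weakly saturated class of maps containing the
generating scaled anodyne maps. -/
def scaledAnodyne : MorphismProperty ScaledSSet.{u} :=
  sInf {W | IsWeaklySaturated W ∧ generatingScaledAnodyne ≤ W}

/-- A weak **S**-fibration: a map with the right lifting property with respect to all scaled
anodyne maps. -/
def IsWeakSFibration {X S : ScaledSSet.{u}} (p : X ⟶ S) : Prop :=
  scaledAnodyne.rlp p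

/-- An ∞-bicategory: a scaled simplicial set with the extension property with respect to all
scaled anodyne maps. -/
def IsInfinityBicategory (X : ScaledSSet.{u}) : Prop :=
  ∀ ⦃A B : ScaledSSet.{u}⦄ (i : A ⟶ B), scaledAnodyne i → ∀ f : A ⟶ X, ∃ g : B ⟶ X, i ≫ g = f

end ScaledSSet

namespace SSet

/-- The map `θ ⋆ [0] : [m] ⋆ [0] ⟶ [n] ⋆ [0]`, that is, the monotone map `[m + 1] ⟶ [n + 1]` which
agrees with `θ` on `[m]` and preserves the last elements. -/
def joinPointHom {m n : SimplexCategory} (θ : m ⟶ n) :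
    Fin (m.len + 1 + 1) →o Fin (n.len + 1 + 1) where
  toFun := Fin.lastCases (motive := fun _ => Fin (n.len + 1 + 1)) (Fin.last (n.len + 1))
    fun j => (θ.toOrderHom j).castSucc
  monotone' := by
    intro i j hij
    induction j using Fin.lastCases with
    | last => simpa using Fin.le_last _
    | cast j =>
      induction i using Fin.lastCases with
      | last => exact absurd hij (not_le.2 (Fin.castSucc_lt_last j))
      | cast i =>
        simpa using θ.toOrderHom.monotone (Fin.castSucc_le_castSucc_iff.1 hij)

theorem joinPointHom_last {m n : SimplexCategory} (θ : m ⟶ n) :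
    joinPointHom θ (Fin.last (m.len + 1)) = Fin.last (n.len + 1) :=
  Fin.lastCases_last (motive := fun _ => Fin (n.len + 1 + 1))

theorem joinPointHom_castSucc {m n : SimplexCategory} (θ : m ⟶ n) (j : Fin (m.len + 1)) :
    joinPointHom θ j.castSucc = (θ.toOrderHom j).castSucc :=
  Fin.lastCases_castSucc (motive := fun _ => Fin (n.len + 1 + 1)) j

/-- The functor `[n] ↦ [n] ⋆ [0] = [n + 1]`, so that `Δ^n ⋆ Δ^0 = Δ^{n+1}`. -/
def joinPoint : SimplexCategory ⥤ SimplexCategory where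
  obj n := ⦋n.len + 1⦌
  map θ := SimplexCategory.Hom.mk (joinPointHom θ)
  map_id n := by
    ext i : 3
    change joinPointHom (𝟙 n) i = i
    induction i using Fin.lastCases with
    | last => exact joinPointHom_last _
    | cast i => exact joinPointHom_castSucc _ i
  map_comp f g := by
    ext i : 3
    change joinPointHom (f ≫ g) i = joinPointHom g (joinPointHom f i)
    induction i using Fin.lastCases with
    | last => rw [joinPointHom_last, joinPointHom_last, joinPointHom_last]
    | cast i =>
      exact (joinPointHom_castSucc _ i).trans
        (((congrArg _ (joinPointHom_castSucc f i)).trans (joinPointHom_castSucc g _)).symm)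

/-- The inclusion `[n] ⟶ [n] ⋆ [0]`. -/
def joinPointInl : 𝟭 SimplexCategory ⟶ joinPoint where
  app n := SimplexCategory.Hom.mk (Fin.castSuccOrderEmb (n := n.len + 1)).toOrderHom
  naturality m n θ := by
    ext i : 3
    exact (joinPointHom_castSucc θ i).symm

/-- The inclusion `[0] ⟶ [n] ⋆ [0]` of the join point. -/
def joinPointInr (n : SimplexCategory) : ⦋0⦌ ⟶ joinPoint.obj n :=
  SimplexCategory.const ⦋0⦌ (joinPoint.obj n) (Fin.last (n.len + 1))

theorem joinPointInr_comp {m n : SimplexCategory} (θ : m ⟶ n) :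
    joinPointInr m ≫ joinPoint.map θ = joinPointInr n := by
  ext i : 3
  exact joinPointHom_last θ

theorem map_op_map_op (X : SSet.{u}) {l m n : SimplexCategory} (f : l ⟶ m) (g : m ⟶ n)
    (x : X.obj (op n)) : X.map f.op (X.map g.op x) = X.map (f ≫ g).op x := by
  simp

theorem map_op_app {X Y : SSet.{u}} (p : X ⟶ Y) {m n : SimplexCategory} (f : m ⟶ n)
    (x : X.obj (op n)) : Y.map f.op (p.app (op n) x) = p.app (op m) (X.map f.op x) :=
  (NatTrans.naturality_apply p f.op x).symm

/-- The simplicial set with `n`-simplices the maps `Δ^n ⋆ Δ^0 ⟶ X`. -/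
def cones (X : SSet.{u}) : SSet.{u} := joinPoint.op ⋙ X

/-- The map of simplicial sets `cones X ⟶ cones Y` given by postcomposition with `f`. -/
def conesMap {X Y : SSet.{u}} (f : X ⟶ Y) : cones X ⟶ cones Y :=
  Functor.whiskerLeft joinPoint.op f

/-- The constant `n`-simplex on a vertex `a`. -/
def constSimplex (X : SSet.{u}) (n : SimplexCategoryᵒᵖ) (a : X _⦋0⦌) : X.obj n :=
  X.map (SimplexCategory.const n.unop ⦋0⦌ 0).op a

/-- The mapping space `X(a, b)`. An `n`-simplex is a map `Δ^0 ⨿_{Δ^n} (Δ^n ⋆ Δ^0) ⟶ X` sending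
the first vertex to `a` and the second to `b`, that is, a map `Δ^n ⋆ Δ^0 ⟶ X` which is
constant at `a` on `Δ^n` and takes the value `b` at the join point. -/
def mappingSpace (X : SSet.{u}) (a b : X _⦋0⦌) : (cones X).Subcomplex where
  obj n := {x |
    X.map (joinPointInl.app n.unop).op x = constSimplex X n a ∧
      X.map (joinPointInr n.unop).op x = b}
  map {m n} θ := by
    rintro x ⟨h₁, h₂⟩
    refine ⟨?_, ?_⟩
    · refine (map_op_map_op X _ _ _).trans ?_
      rw [← joinPointInl.naturality]
      refine (map_op_map_op X θ.unop _ _).symm.trans ?_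
      refine (congrArg (X.map θ.unop.op) h₁).trans ?_
      exact map_op_map_op X _ _ a
    · refine (map_op_map_op X _ _ _).trans ?_
      rw [joinPointInr_comp]
      exact h₂

/-- The map `X(a, b) ⟶ S(p a, p b)` induced by `p : X ⟶ S`. -/
def mappingSpaceMap {X S : SSet.{u}} (p : X ⟶ S) (a b : X _⦋0⦌) :
    (mappingSpace X a b : SSet.{u}) ⟶
      (mappingSpace S (p.app (op ⦋0⦌) a) (p.app (op ⦋0⦌) b) : SSet.{u}) :=
  Subfunctor.lift ((mappingSpace X a b).ι ≫ conesMap p) (by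
    rintro n _ ⟨⟨x, h₁, h₂⟩, rfl⟩
    refine ⟨?_, ?_⟩
    · refine (map_op_app p _ _).trans ((congrArg (p.app _) h₁).trans ?_)
      exact (map_op_app p _ a).symm
    · exact (map_op_app p _ _).trans (congrArg (p.app _) h₂))

/-- The edge `e` of `Y` is `q`-coCartesian: every lifting problem for `Λ^n_0 ⟶ Δ^n` against `q`,
`n ≥ 2`, such that the horn restricts to `e` on `Δ^{0,1}`, has a solution. -/
def IsCoCartesianEdge {Y Z : SSet.{u}} (q : Y ⟶ Z) (e : Y _⦋1⦌) : Prop :=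
  ∀ (n : ℕ) (f : (Λ[n + 2, 0] : SSet.{u}) ⟶ Y) (g : Δ[n + 2] ⟶ Z),
    f ≫ q = Λ[n + 2, 0].ι ≫ g → f.app (op ⦋1⦌) (hornEdge n) = e →
      ∃ l : Δ[n + 2] ⟶ Y, Λ[n + 2, 0].ι ≫ l = f ∧ l ≫ q = g

/-- A 2-simplex is left-degenerate if its restriction to `Δ^{0,1}` is degenerate. -/
def IsLeftDegenerate {X : SSet.{u}} (σ : X _⦋2⦌) : Prop :=
  X.δ 2 σ ∈ X.degenerate 1

/-- The `i`-th vertex of a 2-simplex. -/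
def triangleVertex {X : SSet.{u}} (σ : X _⦋2⦌) (i : Fin 3) : X _⦋0⦌ :=
  X.map (SimplexCategory.const ⦋0⦌ ⦋2⦌ i).op σ

/-- The 2-simplex `σ` of `X` is `p`-coCartesian (this is used for left-degenerate `σ`): every
lifting problem for `Λ^n_0 ⟶ Δ^n` against `p`, `n ≥ 3`, such that the horn restricts to `σ` on
`Δ^{0,1,n}`, has a solution. -/
def IsCoCartesianTriangle {X S : SSet.{u}} (p : X ⟶ S) (σ : X _⦋2⦌) : Prop :=
  ∀ (n : ℕ) (f : (Λ[n + 3, 0] : SSet.{u}) ⟶ X) (g : Δ[n + 3] ⟶ S),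
    f ≫ p = Λ[n + 3, 0].ι ≫ g → f.app (op ⦋2⦌) (hornTriangle n) = σ →
      ∃ l : Δ[n + 3] ⟶ X, Λ[n + 3, 0].ι ≫ l = f ∧ l ≫ p = g

/-- The edge of `X(a, b)` defined by a left-degenerate 2-simplex `σ` with `σ(0) = a` and
`σ(2) = b`. -/
def mappingSpaceEdge {X : SSet.{u}} (σ : X _⦋2⦌) (hσ : IsLeftDegenerate σ) {a b : X _⦋0⦌}
    (ha : triangleVertex σ 0 = a) (hb : triangleVertex σ 2 = b) :
    (mappingSpace X a b : SSet.{u}) _⦋1⦌ :=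
  ⟨σ, by
    subst ha hb
    refine ⟨?_, rfl⟩
    have hδ : (joinPointInl.app ⦋1⦌ : ⦋1⦌ ⟶ ⦋2⦌) = SimplexCategory.δ 2 := by
      ext i : 3
      fin_cases i <;> rfl
    obtain ⟨y, hy⟩ : ∃ y : X _⦋0⦌, X.σ 0 y = X.δ 2 σ := by
      have h := hσ
      rw [IsLeftDegenerate, degenerate_eq_iUnion_range_σ] at h
      simpa using h
    have h0 : triangleVertex σ 0 = y := by
      have h1 : triangleVertex σ 0 = X.map (SimplexCategory.δ 1).op (X.δ 2 σ) := by
        refine Eq.trans ?_ (map_op_map_op X (SimplexCategory.δ 1) (SimplexCategory.δ 2) σ).symm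
        have h2 : SimplexCategory.const ⦋0⦌ ⦋2⦌ 0 =
            SimplexCategory.δ (1 : Fin 2) ≫ SimplexCategory.δ (2 : Fin 3) := by
          ext i : 3
          fin_cases i
          rfl
        rw [triangleVertex, h2]
      rw [h1, ← hy]
      refine (map_op_map_op X _ (SimplexCategory.σ 0) y).trans ?_
      have h2 : SimplexCategory.δ 1 ≫ SimplexCategory.σ (0 : Fin 1) = 𝟙 _ :=
        SimplexCategory.δ_comp_σ_succ
      rw [h2]
      simp
    have h3 : SimplexCategory.σ (0 : Fin 1) = SimplexCategory.const ⦋1⦌ ⦋0⦌ 0 := by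
      ext i : 3
      exact Subsingleton.elim (α := Fin 1) _ _
    change X.map (joinPointInl.app ⦋1⦌).op σ = _
    rw [hδ, h0]
    refine Eq.trans hy.symm ?_
    change X.map (SimplexCategory.σ 0).op y = X.map (SimplexCategory.const ⦋1⦌ ⦋0⦌ 0).op y
    rw [h3]⟩

end SSet

/-! A simplex of `X(a, b)` is a cone in `X` with base constant at `a` and apex `b`, and the horn
`Λ^{n+1}_0` is the union of the cone on `Λ^n_0` and the last face `Δ^{0,…,n}`. Hence the lifting
problems defining coCartesian edges of `X(a, b)` are exactly those lifting problems for outer horns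
defining coCartesian triangles in which the last face is constant at `a`.

An arbitrary last face `h`, whose first edge is degenerate, is reduced to a constant one by moving
its vertices one at a time. Let all vertices after the vertex `i ≥ 1` be mapped by `h` in the same
way, so that `h` sends the triangles beginning with the edge `{i, i + 1}` to degenerate, hence thin,
ones. The given problem is the face opposite to `i + 1` of a problem in one dimension higher, whose
last face is the degenerate simplex repeating the vertex `i` of `h`. Because of the thin triangles
this larger problem is set up and solved by filling inner horns, except for the face opposite to
`i + 2`, which is an outer horn with last face `h` precomposed with the map sending `i + 1` to `i`
and fixing the other vertices. Repeating this, all vertices after `1` are eventually moved to `1`,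
and the last face factors through the first edge of `h`. -/

namespace ScaledSSet

section Gluing

variable {W X Y Y' Z : SSet.{u}} {i : Y ⟶ Z} {j : Y' ⟶ Z}

theorem isPushout_of_isPullback_of_mono [Mono i] [Mono j] {q : W ⟶ Y} {q' : W ⟶ Y'}
    (h : IsPullback q q' i j)
    (hij : SSet.Subcomplex.range i ⊔ SSet.Subcomplex.range j = ⊤) : IsPushout q q' i j where
  w := h.w
  isColimit' := ⟨evaluationJointlyReflectsColimits _ fun m ↦
    (isColimitMapCoconePushoutCoconeEquiv _ _).2 <| IsPushout.isColimit <|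
      Types.isPushout_of_isPullback_of_mono' (h.map ((evaluation _ _).obj m))
        (congrArg (fun A : Z.Subcomplex ↦ A.obj m) hij)
        fun _ _ _ _ hxy ↦ (mono_iff_injective (j.app m)).1 inferInstance hxy⟩

theorem exists_desc_of_range_sup_range_eq_top [Mono i] [Mono j]
    (hij : SSet.Subcomplex.range i ⊔ SSet.Subcomplex.range j = ⊤) (f : Y ⟶ X) (g : Y' ⟶ X)
    (hfg : ∀ m (y : Y.obj m) (y' : Y'.obj m), i.app m y = j.app m y' → f.app m y = g.app m y') :
    ∃ φ : Z ⟶ X, i ≫ φ = f ∧ j ≫ φ = g := by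
  refine (isPushout_of_isPullback_of_mono (IsPullback.of_hasPullback i j) hij).exists_desc f g ?_
  ext m z
  have hz : (pullback.fst i j ≫ i).app m z = (pullback.snd i j ≫ j).app m z := by
    rw [pullback.condition]
  exact hfg m _ _ hz

theorem hom_ext_of_range_sup_range_eq_top
    (hij : SSet.Subcomplex.range i ⊔ SSet.Subcomplex.range j = ⊤) {φ ψ : Z ⟶ X}
    (hi : i ≫ φ = i ≫ ψ) (hj : j ≫ φ = j ≫ ψ) : φ = ψ := by
  ext m z
  have hz : z ∈ (SSet.Subcomplex.range i ⊔ SSet.Subcomplex.range j).obj m := hij ▸ Set.mem_univ z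
  obtain ⟨y, rfl⟩ | ⟨y, rfl⟩ := hz
  · exact ConcreteCategory.congr_hom (NatTrans.congr_app hi m) y
  · exact ConcreteCategory.congr_hom (NatTrans.congr_app hj m) y

variable {A B : Z.Subcomplex}

theorem range_homOfLE_sup_range_lift (hAB : A ≤ B) (hB : A ⊔ SSet.Subcomplex.range i = B) :
    SSet.Subcomplex.range (SSet.Subcomplex.homOfLE hAB) ⊔
      SSet.Subcomplex.range (SSet.Subcomplex.lift i (le_sup_right.trans_eq hB)) = ⊤ := by
  refine top_le_iff.1 fun m b _ ↦ ?_
  obtain hb | ⟨y, hy⟩ : b.1 ∈ (A ⊔ SSet.Subcomplex.range i).obj m := hB ▸ b.2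
  · exact Or.inl ⟨⟨b.1, hb⟩, rfl⟩
  · exact Or.inr ⟨y, Subtype.ext hy⟩

theorem exists_desc_of_sup_range_eq [Mono i] (hAB : A ≤ B)
    (hB : A ⊔ SSet.Subcomplex.range i = B) (f : (A : SSet.{u}) ⟶ X) (l : Y ⟶ X)
    (hfl : (A.preimage i).ι ≫ l = A.fromPreimage i ≫ f) :
    ∃ φ : (B : SSet.{u}) ⟶ X, SSet.Subcomplex.homOfLE hAB ≫ φ = f ∧
      SSet.Subcomplex.lift i (le_sup_right.trans_eq hB) ≫ φ = l := by
  have : Mono (SSet.Subcomplex.lift i (le_sup_right.trans_eq hB)) :=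
    mono_of_mono_fac (SSet.Subcomplex.lift_ι i _)
  refine exists_desc_of_range_sup_range_eq_top (range_homOfLE_sup_range_lift hAB hB) f l
    fun m ⟨z, hz⟩ y hzy ↦ ?_
  obtain rfl : z = i.app m y := congrArg Subtype.val hzy
  exact (ConcreteCategory.congr_hom (NatTrans.congr_app hfl m) ⟨y, hz⟩).symm

end Gluing

section ScaledLifting

variable {X S : ScaledSSet.{u}} {p : X ⟶ S}

/-- The map of scaled simplicial sets `(Y, i⁻¹ T) ⟶ (Z, T)` defined by a map `i : Y ⟶ Z` and a set
`T` of triangles of `Z`. For the inclusion of a subcomplex this is `subcomplexInclusion`. -/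
def inducedMap {Y Z : SSet.{u}} (i : Y ⟶ Z) (T : Set (Z _⦋2⦌)) :
    ofTriangles Y {t | i.app (op ⦋2⦌) t ∈ T} ⟶ ofTriangles Z T :=
  ofTrianglesMap i _ T fun _ ht ↦ ht

/-- A map of simplicial sets `Y ⟶ X` carrying `T` into the thin triangles of `X`, as a map
`(Y, T) ⟶ X` of scaled simplicial sets. -/
def ofTrianglesDesc {Y : SSet.{u}} {T : Set (Y _⦋2⦌)} (f : Y ⟶ X.toSSet)
    (hf : ∀ t ∈ T, f.app (op ⦋2⦌) t ∈ X.thin) : ofTriangles Y T ⟶ X where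
  toHom := f
  map_thin := by
    rintro t (ht | ht)
    · exact hf t ht
    · exact X.degenerate_subset_thin (SSet.degenerate_le_preimage f 2 ht)

theorem hasLiftingProperty_inducedMap_iff {Y Z : SSet.{u}} {i : Y ⟶ Z} {T : Set (Z _⦋2⦌)} :
    HasLiftingProperty (inducedMap i T) p ↔ ∀ (f : Y ⟶ X.toSSet) (g : Z ⟶ S.toSSet),
      f ≫ p.toHom = i ≫ g → (∀ t, i.app (op ⦋2⦌) t ∈ T → f.app (op ⦋2⦌) t ∈ X.thin) →
        (∀ t ∈ T, g.app (op ⦋2⦌) t ∈ S.thin) →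
          ∃ l : Z ⟶ X.toSSet, i ≫ l = f ∧ l ≫ p.toHom = g ∧
            ∀ t ∈ T, l.app (op ⦋2⦌) t ∈ X.thin := by
  refine ⟨fun h f g comm hf hg ↦ ?_, fun h ↦ ⟨fun {f g} sq ↦ ?_⟩⟩
  · obtain ⟨⟨l, hl, hl'⟩⟩ := h.sq_hasLift (f := ofTrianglesDesc f hf) (g := ofTrianglesDesc g hg)
      ⟨Hom.ext comm⟩
    exact ⟨l.toHom, congrArg Hom.toHom hl, congrArg Hom.toHom hl',
      fun t ht ↦ l.map_thin t (Or.inl ht)⟩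
  · obtain ⟨l, hl, hl', hT⟩ := h f.toHom g.toHom (congrArg Hom.toHom sq.w)
      (fun t ht ↦ f.map_thin t (Or.inl ht)) (fun t ht ↦ g.map_thin t (Or.inl ht))
    exact ⟨⟨⟨ofTrianglesDesc l hT, Hom.ext hl, Hom.ext hl'⟩⟩⟩

/-- The inclusion `(A, T) ⟶ (B, T)` for subcomplexes `A ≤ B` of `Y` and a set `T` of triangles of
`Y`, of which only those lying in `A`, respectively `B`, are retained. -/
def inclusion {Y : SSet.{u}} {A B : Y.Subcomplex} (h : A ≤ B) (T : Set (Y _⦋2⦌)) :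
    ofTriangles (A : SSet.{u}) {t | A.ι.app (op ⦋2⦌) t ∈ T} ⟶
      ofTriangles (B : SSet.{u}) {t | B.ι.app (op ⦋2⦌) t ∈ T} :=
  inducedMap (SSet.Subcomplex.homOfLE h) {t | B.ι.app (op ⦋2⦌) t ∈ T}

theorem hasLiftingProperty_subcomplexInclusion {Y : SSet.{u}} {A : Y.Subcomplex}
    {T : Set (Y _⦋2⦌)} (h : HasLiftingProperty (inclusion (le_top : A ≤ ⊤) T) p) :
    HasLiftingProperty (subcomplexInclusion A T) p := by
  have : IsIso (subcomplexInclusion (⊤ : Y.Subcomplex) T) :=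
    ⟨ofTrianglesMap (SSet.Subcomplex.topIso Y).inv T _ fun _ ht ↦ ht, rfl, rfl⟩
  exact HasLiftingProperty.of_comp_left (inclusion (le_top : A ≤ ⊤) T) (subcomplexInclusion ⊤ T) p

theorem hasLiftingProperty_inclusion_of_cell {Y Z : SSet.{u}} {e : Z ⟶ Y} [Mono e]
    {A B : Y.Subcomplex} (hAB : A ≤ B) (hB : A ⊔ SSet.Subcomplex.range e = B)
    {T : Set (Y _⦋2⦌)} {U : Set (Z _⦋2⦌)} (hU : ∀ t ∈ U, e.app (op ⦋2⦌) t ∈ T)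
    (hT : ∀ t, e.app (op ⦋2⦌) t ∈ T → e.app (op ⦋2⦌) t ∉ A.obj (op ⦋2⦌) → t ∈ U)
    (h : HasLiftingProperty (subcomplexInclusion (A.preimage e) U) p) :
    HasLiftingProperty (inclusion hAB T) p := by
  refine hasLiftingProperty_inducedMap_iff.2 fun f g comm hf hg ↦ ?_
  let eB : Z ⟶ B := SSet.Subcomplex.lift e (le_sup_right.trans_eq hB)
  obtain ⟨l, hl, hl', hlU⟩ := hasLiftingProperty_inducedMap_iff.1 h (A.fromPreimage e ≫ f) (eB ≫ g)
    (by rw [Category.assoc, comm]; rfl) (fun t ht ↦ hf _ (hU _ ht)) (fun t ht ↦ hg _ (hU t ht))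
  obtain ⟨φ, hφ, hφ'⟩ := exists_desc_of_sup_range_eq hAB hB f l hl
  have hφg : φ ≫ p.toHom = g := by
    refine hom_ext_of_range_sup_range_eq_top (range_homOfLE_sup_range_lift hAB hB) ?_ ?_
    · rw [← Category.assoc, hφ, comm]
    · rw [← Category.assoc, hφ', hl']
  refine ⟨φ, hφ, hφg, fun t ht ↦ ?_⟩
  obtain ⟨t, htB⟩ := t
  by_cases htA : t ∈ A.obj _
  · have := hf ⟨t, htA⟩ ht
    rwa [← hφ] at this
  · obtain ⟨z, rfl⟩ : t ∈ (SSet.Subcomplex.range e).obj _ :=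
      ((hB ▸ htB : t ∈ (A ⊔ SSet.Subcomplex.range e).obj _)).resolve_left htA
    have := hlU z (hT z ht htA)
    rwa [← hφ'] at this

end ScaledLifting

section Faces

variable {M N : ℕ}

/-- The set of vertices of a simplex of `Δ[N]`. -/
def vertices {m : SimplexCategoryᵒᵖ} (z : (Δ[N] : SSet.{u}).obj m) : Finset (Fin (N + 1)) :=
  Finset.univ.image (SSet.stdSimplex.asOrderHom z)

theorem mem_vertices {m : ℕ} {z : (Δ[N] : SSet.{u}) _⦋m⦌} {j : Fin (N + 1)} :
    j ∈ vertices z ↔ ∃ k, z k = j := by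
  simp only [vertices, Finset.mem_image, Finset.mem_univ, true_and]
  rfl

theorem vertices_map_subset {l m : SimplexCategoryᵒᵖ} (γ : l ⟶ m)
    (z : (Δ[N] : SSet.{u}).obj l) : vertices ((Δ[N] : SSet.{u}).map γ z) ⊆ vertices z :=
  Finset.image_subset_iff.2 fun k _ ↦
    Finset.mem_image_of_mem _ (Finset.mem_univ (γ.unop.toOrderHom k))

/-- The subcomplex of `Δ[N]` of the simplices whose set of vertices belongs to the lower set
`F`. -/
def faceComplex (F : LowerSet (Finset (Fin (N + 1)))) : (Δ[N] : SSet.{u}).Subcomplex where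
  obj _ := {z | vertices z ∈ F}
  map γ z hz := F.lower (vertices_map_subset γ z) hz

theorem faceComplex_mono {F G : LowerSet (Finset (Fin (N + 1)))} (h : F ≤ G) :
    faceComplex.{u} F ≤ faceComplex G :=
  fun _ _ hz ↦ h hz

theorem mem_horn_iff_exists_notMem_vertices {i : Fin (N + 1)} {m : SimplexCategoryᵒᵖ}
    {z : (Δ[N] : SSet.{u}).obj m} :
    z ∈ (SSet.horn N i).obj m ↔ ∃ j, j ≠ i ∧ j ∉ vertices z := by
  simp only [SSet.mem_horn_iff, vertices, ne_eq, Set.eq_univ_iff_forall, not_forall,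
    Set.mem_union, Set.mem_range, Set.mem_singleton_iff, Finset.mem_image, Finset.mem_univ,
    true_and, not_or]
  exact exists_congr fun j ↦ and_comm

/-- The map `Δ[M] ⟶ Δ[N]` given by a strictly increasing map on vertices. -/
abbrev faceMap (e : Fin (M + 1) ↪o Fin (N + 1)) : (Δ[M] : SSet.{u}) ⟶ Δ[N] :=
  SSet.stdSimplex.map (SimplexCategory.mkHom e.toOrderHom)

variable (e : Fin (M + 1) ↪o Fin (N + 1))

instance mono_faceMap : Mono (faceMap.{u} e) :=
  have : Mono (SimplexCategory.mkHom e.toOrderHom) :=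
    SimplexCategory.mono_iff_injective.2 e.injective
  (NatTrans.mono_iff_mono_app _).2 fun _ ↦ (mono_iff_injective _).2 fun _ _ h ↦
    SSet.stdSimplex.objEquiv.injective <| (cancel_mono (SimplexCategory.mkHom e.toOrderHom)).1 <|
      congrArg SSet.stdSimplex.objEquiv h

theorem vertices_faceMap {m : SimplexCategoryᵒᵖ} (z : (Δ[M] : SSet.{u}).obj m) :
    vertices ((faceMap e).app m z) = (vertices z).image e := by
  rw [vertices, vertices, Finset.image_image]
  rfl

theorem range_faceMap :
    SSet.Subcomplex.range (faceMap.{u} e) = faceComplex (LowerSet.Iic (Finset.univ.image e)) := by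
  ext m z
  refine ⟨?_, fun hz ↦ ?_⟩
  · rintro ⟨z, rfl⟩
    exact (vertices_faceMap e z).trans_subset (Finset.image_subset_image (Finset.subset_univ _))
  · have hrange : ∀ k, ∃ j, e j = SSet.stdSimplex.asOrderHom z k := fun k ↦ by
      simpa using hz (Finset.mem_image_of_mem _ (Finset.mem_univ k))
    choose γ hγ using hrange
    have hγ' : Monotone γ := fun k k' hk ↦ e.le_iff_le.1 <| by
      simpa only [hγ] using (SSet.stdSimplex.asOrderHom z).monotone hk
    refine ⟨SSet.stdSimplex.objMk ⟨γ, hγ'⟩, SSet.stdSimplex.objEquiv.injective ?_⟩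
    ext k : 3
    exact hγ k

end Faces

section InnerAnodyne

/-- The triangle `Δ^{i,i+1,i+2}` of `Δ^{n+2}`. -/
def innerTriangle {n : ℕ} (i : Fin (n + 1)) : (Δ[n + 2] : SSet.{u}) _⦋2⦌ :=
  SSet.stdSimplex.triangle i.castSucc.castSucc i.castSucc.succ i.succ.succ
    (Fin.castSucc_le_succ _) (Fin.succ_le_succ_iff.2 (Fin.castSucc_le_succ _))

/-- The inner horn inclusions `(Λ^n_i, {Δ^{i-1,i,i+1}}) ⟶ (Δ^n, {Δ^{i-1,i,i+1}})`, the first of the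
three families of generating scaled anodyne maps. -/
inductive innerHornInclusions : MorphismProperty ScaledSSet.{u} where
  | mk (n : ℕ) (i : Fin (n + 1)) : innerHornInclusions
      (subcomplexInclusion (SSet.horn (n + 2) i.castSucc.succ) {innerTriangle i})

theorem innerHornInclusions_le_scaledAnodyne : innerHornInclusions.{u} ≤ scaledAnodyne := by
  rintro _ _ _ ⟨n, i⟩
  exact (le_sInf fun _ h ↦ h.2 : generatingScaledAnodyne ≤ scaledAnodyne) _ (.inner n i)

variable {X S : ScaledSSet.{u}} {p : X ⟶ S} {N : ℕ}

theorem eq_innerTriangle {n : ℕ} {i : Fin (n + 1)} {τ : (Δ[n + 2] : SSet.{u}) _⦋2⦌}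
    (hτ : τ ∉ (SSet.horn (n + 2) i.castSucc.succ).obj (op ⦋2⦌)) (h₁ : τ 1 = i.castSucc.succ) :
    τ = innerTriangle i := by
  simp only [mem_horn_iff_exists_notMem_vertices, not_exists, not_and, not_not] at hτ
  have h₀₁ : τ 0 ≤ τ 1 := (SSet.stdSimplex.asOrderHom τ).monotone (Fin.zero_le 1)
  have h₁₂ : τ 1 ≤ τ 2 := (SSet.stdSimplex.asOrderHom τ).monotone (Fin.le_last 1)
  have hi : i.castSucc.castSucc < i.castSucc.succ := Fin.castSucc_lt_succ
  have hi' : i.castSucc.succ < i.succ.succ := Fin.succ_lt_succ_iff.2 Fin.castSucc_lt_succ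
  obtain ⟨k, hk⟩ := mem_vertices.1 (hτ _ hi.ne)
  obtain ⟨k', hk'⟩ := mem_vertices.1 (hτ _ hi'.ne')
  have h₀ : τ 0 = i.castSucc.castSucc := by
    fin_cases k
    exacts [hk, absurd (hk.symm.trans h₁) hi.ne,
      absurd (h₁.symm.trans_le (h₁₂.trans_eq hk)) hi.not_ge]
  have h₂ : τ 2 = i.succ.succ := by
    fin_cases k'
    exacts [absurd (hk'.symm.trans_le (h₀₁.trans_eq h₁)) hi'.not_ge,
      absurd (hk'.symm.trans h₁) hi'.ne', hk']
  refine SSet.stdSimplex.ext _ _ fun k ↦ ?_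
  fin_cases k
  exacts [h₀, h₁, h₂]

theorem preimage_faceComplex_faceMap {n : ℕ} {e : Fin (n + 3) ↪o Fin (N + 1)} {i : Fin (n + 3)}
    {F : LowerSet (Finset (Fin (N + 1)))} (hF : ∀ j ≠ i, (Finset.univ.erase j).image e ∈ F)
    (hi : (Finset.univ.erase i).image e ∉ F) :
    (faceComplex.{u} F).preimage (faceMap e) = Λ[n + 2, i] := by
  ext m z
  rw [mem_horn_iff_exists_notMem_vertices]
  refine ⟨fun hz ↦ ?_, fun ⟨j, hji, hj⟩ ↦ ?_⟩
  · by_contra! h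
    refine hi (F.lower (Finset.image_subset_iff.2 fun j hj ↦ ?_) hz)
    rw [vertices_faceMap]
    exact Finset.mem_image_of_mem e (h j (Finset.ne_of_mem_erase hj))
  · refine F.lower ?_ (hF j hji)
    rw [vertices_faceMap]
    exact Finset.image_subset_image (Finset.subset_erase.2 ⟨Finset.subset_univ _, hj⟩)

theorem hasLiftingProperty_inclusion_face (hp : innerHornInclusions.rlp p) {n : ℕ}
    (i : Fin (n + 1)) (e : Fin (n + 3) ↪o Fin (N + 1)) {F : LowerSet (Finset (Fin (N + 1)))}
    (hF : ∀ j ≠ i.castSucc.succ, (Finset.univ.erase j).image e ∈ F)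
    (hi : (Finset.univ.erase i.castSucc.succ).image e ∉ F) {T : Set ((Δ[N] : SSet.{u}) _⦋2⦌)}
    (hmid : (faceMap e).app (op ⦋2⦌) (innerTriangle i) ∈ T)
    (hT : ∀ τ, (faceMap e).app (op ⦋2⦌) τ ∈ T → vertices ((faceMap e).app (op ⦋2⦌) τ) ∉ F →
      τ 1 = i.castSucc.succ) :
    HasLiftingProperty
      (inclusion (faceComplex_mono (le_sup_left : F ≤ F ⊔ LowerSet.Iic (Finset.univ.image e))) T)
      p := by
  have hpre := preimage_faceComplex_faceMap.{u} hF hi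
  refine hasLiftingProperty_inclusion_of_cell (e := faceMap e) (U := {innerTriangle i}) _
    ?_ ?_ ?_ ?_
  · rw [range_faceMap]
    rfl
  · rintro _ rfl
    exact hmid
  · intro τ hτ hτF
    exact eq_innerTriangle (hpre ▸ hτF) (hT τ hτ hτF)
  · rw [hpre]
    exact hp _ ⟨n, i⟩

theorem exists_orderEmbedding_image_eq {s : Finset (Fin (N + 1))} {u v w : Fin (N + 1)}
    (hu : u ∈ s) (hv : v ∈ s) (hw : w ∈ s) (huv : u < v) (hvw : v < w) :
    ∃ (n : ℕ) (i : Fin (n + 1)) (e : Fin (n + 3) ↪o Fin (N + 1)),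
      Finset.univ.image e = s ∧ e i.castSucc.succ = v := by
  obtain ⟨n, hn⟩ : ∃ n, s.card = n + 3 := by
    refine ⟨s.card - 3, (Nat.sub_add_cancel (Finset.two_lt_card.2 ?_)).symm⟩
    exact ⟨u, hu, v, hv, w, hw, huv.ne, (huv.trans hvw).ne, hvw.ne⟩
  have hs : Finset.univ.image (s.orderEmbOfFin hn) = s := Finset.image_orderEmbOfFin_univ s hn
  have hmem : ∀ x ∈ s, ∃ j, s.orderEmbOfFin hn j = x := fun x hx ↦
    (s.range_orderEmbOfFin hn).ge hx
  obtain ⟨a, rfl⟩ := hmem u hu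
  obtain ⟨b, rfl⟩ := hmem v hv
  obtain ⟨c, rfl⟩ := hmem w hw
  have hab : a < b := (s.orderEmbOfFin hn).lt_iff_lt.1 huv
  have hbc : b < c := (s.orderEmbOfFin hn).lt_iff_lt.1 hvw
  exact ⟨n, ⟨b - 1, by lia⟩, s.orderEmbOfFin hn, hs, congrArg _ (Fin.ext (by simp; lia))⟩

end InnerAnodyne

section Matching

variable {N : ℕ}

/-- For lower sets `F` and `G` of faces of `Δ[N]`, the faces in `G` but not in `F` come in pairs
`{t \ {v}, t ∪ {v}}` in each of which `t \ {v}` is an inner face of `t ∪ {v}`, and `T` supplies the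
thin triangles required to attach the simplices `t ∪ {v}` along the corresponding inner horns. -/
structure IsInnerMatched (v : Fin (N + 1)) (T : Set ((Δ[N] : SSet.{u}) _⦋2⦌))
    (F G : LowerSet (Finset (Fin (N + 1)))) : Prop where
  insert_mem : ∀ t ∈ G, t ∉ F → insert v t ∈ G
  erase_notMem : ∀ t ∈ G, t ∉ F → t.erase v ∉ F
  exists_lt : ∀ t ∈ G, t ∉ F → ∃ u ∈ t, u < v
  exists_gt : ∀ t ∈ G, t ∉ F → ∃ w ∈ t, v < w
  mem_of_consecutive : ∀ t ∈ G, t ∉ F → ∀ τ : (Δ[N] : SSet.{u}) _⦋2⦌, τ 0 ∈ t → τ 0 < v →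
    τ 1 = v → v < τ 2 → τ 2 ∈ t → (∀ x ∈ t, x ≤ τ 0 ∨ x = v ∨ τ 2 ≤ x) → τ ∈ T
  apply_one_eq : ∀ τ ∈ T, vertices τ ∈ G → vertices τ ∉ F → τ 1 = v

namespace IsInnerMatched

variable {X S : ScaledSSet.{u}} {p : X ⟶ S} {v : Fin (N + 1)} {T : Set ((Δ[N] : SSet.{u}) _⦋2⦌)}
  {F G : LowerSet (Finset (Fin (N + 1)))}

theorem exists_minimal (h : IsInnerMatched v T F G) (hFG : F < G) :
    ∃ s, (s ∈ G ∧ s ∉ F ∧ v ∈ s) ∧ ∀ x ∈ s, x ≠ v → s.erase x ∈ F := by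
  obtain ⟨t, htG, htF⟩ := Set.exists_of_ssubset (LowerSet.coe_ssubset_coe.2 hFG)
  obtain ⟨s, hs⟩ := (Set.toFinite {s | s ∈ G ∧ s ∉ F ∧ v ∈ s}).exists_minimal
    ⟨insert v t, h.insert_mem t htG htF, fun h' ↦ htF (F.lower (Finset.subset_insert v t) h'),
      Finset.mem_insert_self v t⟩
  refine ⟨s, hs.prop, fun x hx hxv ↦ by_contra fun hxF ↦ Finset.notMem_erase x s ?_⟩
  refine hs.le_of_le ⟨?_, hxF, ?_⟩ (Finset.erase_subset x s) hx
  · exact G.lower (Finset.erase_subset x s) hs.prop.1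
  · exact Finset.mem_erase.2 ⟨hxv.symm, hs.prop.2.2⟩

theorem sup_Iic (h : IsInnerMatched v T F G) {s : Finset (Fin (N + 1))} (hs : v ∈ s) :
    IsInnerMatched v T (F ⊔ LowerSet.Iic s) G where
  insert_mem t htG htF := h.insert_mem t htG fun h' ↦ htF (Or.inl h')
  erase_notMem t htG htF := by
    rintro (h' | h')
    · exact h.erase_notMem t htG (fun h' ↦ htF (Or.inl h')) h'
    · exact htF (Or.inr ((Finset.erase_subset_iff_of_mem hs).1 h'))
  exists_lt t htG htF := h.exists_lt t htG fun h' ↦ htF (Or.inl h')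
  exists_gt t htG htF := h.exists_gt t htG fun h' ↦ htF (Or.inl h')
  mem_of_consecutive t htG htF := h.mem_of_consecutive t htG fun h' ↦ htF (Or.inl h')
  apply_one_eq τ hτ hτG hτF := h.apply_one_eq τ hτ hτG fun h' ↦ hτF (Or.inl h')

theorem hasLiftingProperty_sup_Iic (h : IsInnerMatched v T F G)
    (hp : innerHornInclusions.rlp p) {s : Finset (Fin (N + 1))} (hsG : s ∈ G) (hsF : s ∉ F)
    (hvs : v ∈ s) (hs : ∀ x ∈ s, x ≠ v → s.erase x ∈ F) :
    HasLiftingProperty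
      (inclusion (faceComplex_mono (le_sup_left : F ≤ F ⊔ LowerSet.Iic s)) T) p := by
  obtain ⟨u, hu, huv⟩ := h.exists_lt s hsG hsF
  obtain ⟨w, hw, hvw⟩ := h.exists_gt s hsG hsF
  obtain ⟨n, i, e, rfl, rfl⟩ := exists_orderEmbedding_image_eq hu hvs hw huv hvw
  have himage : ∀ j, (Finset.univ.erase j).image e = (Finset.univ.image e).erase (e j) :=
    fun j ↦ Finset.image_erase e.injective _ j
  have hmem : ∀ j, e j ∈ Finset.univ.image e := fun j ↦
    Finset.mem_image_of_mem e (Finset.mem_univ j)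
  refine hasLiftingProperty_inclusion_face hp i e (fun j hj ↦ ?_) ?_ ?_ fun τ hτ hτF ↦ ?_
  · exact himage j ▸ hs _ (hmem j) (e.injective.ne hj)
  · exact himage _ ▸ h.erase_notMem _ hsG hsF
  · refine h.mem_of_consecutive _ hsG hsF _ (hmem _) ?_ rfl ?_ (hmem _) fun x hx ↦ ?_
    · exact e.lt_iff_lt.2 Fin.castSucc_lt_succ
    · exact e.lt_iff_lt.2 (Fin.succ_lt_succ_iff.2 Fin.castSucc_lt_succ)
    · obtain ⟨j, -, rfl⟩ := Finset.mem_image.1 hx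
      change e j ≤ e i.castSucc.castSucc ∨ e j = _ ∨ e i.succ.succ ≤ e j
      rw [e.le_iff_le, e.le_iff_le, e.injective.eq_iff]
      simp only [Fin.le_def, Fin.ext_iff, Fin.val_castSucc, Fin.val_succ]
      lia
  · exact e.injective (h.apply_one_eq _ hτ (G.lower (by
      rw [vertices_faceMap]
      exact Finset.image_subset_image (Finset.subset_univ _)) hsG) hτF)

theorem hasLiftingProperty (h : IsInnerMatched v T F G) (hp : innerHornInclusions.rlp p)
    (hFG : F ≤ G) : HasLiftingProperty (inclusion (faceComplex_mono hFG) T) p := by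
  have : Finite (LowerSet (Finset (Fin (N + 1)))) := Finite.of_injective _ SetLike.coe_injective
  induction F using WellFoundedGT.induction with | ind F ih
  obtain rfl | hlt := hFG.eq_or_lt
  · exact inferInstanceAs (HasLiftingProperty (𝟙 _) p)
  · obtain ⟨s, ⟨hsG, hsF, hvs⟩, hs⟩ := h.exists_minimal hlt
    have hF : F ≤ F ⊔ LowerSet.Iic s := le_sup_left
    have hG : F ⊔ LowerSet.Iic s ≤ G := sup_le hFG (LowerSet.Iic_le.2 hsG)
    have hcell := h.hasLiftingProperty_sup_Iic hp hsG hsF hvs hs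
    have hlt' : F < F ⊔ LowerSet.Iic s := hF.lt_of_not_ge fun h' ↦
      hsF (h' (Or.inr (LowerSet.mem_Iic_iff.2 le_rfl)))
    have hrest := ih _ hlt' (h.sup_Iic hvs) hG
    exact inferInstanceAs (HasLiftingProperty
      (inclusion (faceComplex_mono hF) T ≫ inclusion (faceComplex_mono hG) T) p)

end IsInnerMatched

end Matching

section MatchedFaces

variable {N : ℕ}

/-- The faces of `Δ[N]` not containing the vertex `j`. -/
def omitting (j : Fin (N + 1)) : LowerSet (Finset (Fin (N + 1))) where
  carrier := {t | j ∉ t}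
  lower' _ _ hst hs hj := hs (hst hj)

/-- The faces of `Δ[N]` omitting some vertex outside `s`. For `s = {i}` these are the faces of the
horn `Λ[N, i]`. -/
def hornFaces (s : Finset (Fin (N + 1))) : LowerSet (Finset (Fin (N + 1))) where
  carrier := {t | ∃ j ∉ s, j ∉ t}
  lower' := fun _ _ hst ⟨j, hjs, hj⟩ ↦ ⟨j, hjs, fun h ↦ hj (hst h)⟩

variable {i k k' : Fin (N + 1)}

theorem isInnerMatched_of_omitting_last_le (hkk' : (k : ℕ) + 1 = k') (hk' : k' < Fin.last N)
    {F G : LowerSet (Finset (Fin (N + 1)))} (hF : omitting (Fin.last N) ≤ F)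
    (hG : ∀ t ∈ G, t ∉ F → k ∈ t ∧ insert k' t ∈ G ∧ t.erase k' ∉ F) :
    IsInnerMatched.{u} k' {τ | τ 0 = k ∧ τ 1 = k'} F G where
  insert_mem t htG htF := (hG t htG htF).2.1
  erase_notMem t htG htF := (hG t htG htF).2.2
  exists_lt t htG htF := ⟨k, (hG t htG htF).1, by lia⟩
  exists_gt t _ htF := ⟨Fin.last N, by_contra fun h ↦ htF (hF h), hk'⟩
  mem_of_consecutive t htG htF τ _ h₀ h₁ h₂ _ h := by
    have := h k (hG t htG htF).1
    exact ⟨by lia, h₁⟩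
  apply_one_eq τ hτ _ _ := hτ.2

theorem isInnerMatched_omitting_top (hkk' : (k : ℕ) + 1 = k') (hk' : k' < Fin.last N) :
    IsInnerMatched.{u} k' {τ | τ 0 = k ∧ τ 1 = k'} (omitting (Fin.last N) ⊔ omitting k) ⊤ := by
  refine isInnerMatched_of_omitting_last_le hkk' hk' le_sup_left fun t _ ht ↦ ?_
  have hkt : k ∈ t := by_contra fun h ↦ ht (Or.inr h)
  have hlt : Fin.last N ∈ t := by_contra fun h ↦ ht (Or.inl h)
  refine ⟨hkt, trivial, ?_⟩
  rintro (h | h)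
  · exact h (Finset.mem_erase.2 ⟨hk'.ne', hlt⟩)
  · exact h (Finset.mem_erase.2 ⟨by lia, hkt⟩)

theorem isInnerMatched_hornFaces_pair (hkk' : (k : ℕ) + 1 = k') (hk' : k' < Fin.last N) :
    IsInnerMatched.{u} k' {τ | τ 0 = k ∧ τ 1 = k'}
      (omitting (Fin.last N) ⊔ omitting k ⊓ hornFaces {0, k})
      (hornFaces {0, k, k'} ⊔ omitting k ⊓ omitting k') := by
  refine isInnerMatched_of_omitting_last_le hkk' hk' le_sup_left fun t htG htF ↦ ?_
  have hlt : Fin.last N ∈ t := by_contra fun h ↦ htF (Or.inl h)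
  have hkt : k ∈ t := by_contra fun hk ↦ by
    have hmem : ∀ j, j ∉ ({0, k} : Finset (Fin (N + 1))) → j ∈ t :=
      fun j hj ↦ by_contra fun hjt ↦ htF (Or.inr ⟨hk, j, hj, hjt⟩)
    obtain ⟨j, hj, hjt⟩ | ⟨-, hk't⟩ := htG
    · exact hjt (hmem j fun h ↦ hj (by grind))
    · exact hk't (hmem k' (by simp only [Finset.mem_insert, Finset.mem_singleton]; lia))
  refine ⟨hkt, ?_, ?_⟩
  · obtain ⟨j, hj, hjt⟩ | ⟨hk, -⟩ := htG
    · exact Or.inl ⟨j, hj, fun h ↦ (Finset.mem_insert.1 h).elim (fun h ↦ hj (by simp [h])) hjt⟩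
    · exact absurd hkt hk
  · rintro (h | ⟨h, -⟩)
    · exact h (Finset.mem_erase.2 ⟨hk'.ne', hlt⟩)
    · exact h (Finset.mem_erase.2 ⟨by lia, hkt⟩)

theorem isInnerMatched_hornFaces_top (hi : i ≠ 0) (hik : (i : ℕ) + 1 = k)
    (hkk' : (k : ℕ) + 1 = k') :
    IsInnerMatched.{u} k {τ | τ 0 = i ∧ τ 1 = k ∧ τ 2 = k'} (hornFaces {0, k}) ⊤ := by
  have hmem : ∀ {t : Finset (Fin (N + 1))}, t ∉ hornFaces {0, k} → ∀ j, j ≠ 0 → j ≠ k → j ∈ t :=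
    fun ht j hj₀ hjk ↦ by_contra fun hj ↦ ht ⟨j, by simp [hj₀, hjk], hj⟩
  refine ⟨fun _ _ _ ↦ trivial, fun t _ ht ⟨j, hj, hjt⟩ ↦ ht ⟨j, hj, fun h ↦ hjt ?_⟩,
    fun t _ ht ↦ ⟨i, hmem ht i hi (by lia), by lia⟩,
    fun t _ ht ↦ ⟨k', hmem ht k' (by lia) (by lia), by lia⟩,
    fun t _ ht τ _ h₀ h₁ h₂ _ h ↦ ?_, fun τ hτ _ _ ↦ hτ.2.1⟩
  · exact Finset.mem_erase.2 ⟨fun h ↦ hj (by simp [h]), h⟩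
  · have := h i (hmem ht i hi (by lia))
    have := h k' (hmem ht k' (by lia) (by lia))
    exact ⟨by lia, h₁, by lia⟩

end MatchedFaces

section Vertices

variable {N : ℕ}

theorem mem_range_δ_iff {j : Fin (N + 2)} {m : SimplexCategoryᵒᵖ}
    {z : (Δ[N + 1] : SSet.{u}).obj m} :
    z ∈ (SSet.Subcomplex.range (SSet.stdSimplex.δ j)).obj m ↔ j ∉ vertices z := by
  rw [show SSet.stdSimplex.δ j = faceMap j.succAboveOrderEmb from rfl, range_faceMap]
  change vertices z ⊆ Finset.univ.image j.succAbove ↔ _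
  rw [Fin.image_succAbove_univ, Finset.subset_compl_singleton]

theorem succAbove_mem_vertices_δ_iff {j : Fin (N + 2)} {k : Fin (N + 1)} {m : SimplexCategoryᵒᵖ}
    {z : (Δ[N] : SSet.{u}).obj m} :
    j.succAbove k ∈ vertices ((SSet.stdSimplex.δ j).app m z) ↔ k ∈ vertices z := by
  rw [show SSet.stdSimplex.δ j = faceMap j.succAboveOrderEmb from rfl, vertices_faceMap]
  exact j.succAboveOrderEmb.injective.mem_finset_image

theorem exists_of_δ_castSucc_eq_δ_succ {i j : Fin (N + 2)} (hij : i ≤ j) {m : SimplexCategoryᵒᵖ}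
    {y z : (Δ[N + 1] : SSet.{u}).obj m}
    (h : (SSet.stdSimplex.δ i.castSucc).app m z = (SSet.stdSimplex.δ j.succ).app m y) :
    ∃ w, z = (SSet.stdSimplex.δ j).app m w ∧ y = (SSet.stdSimplex.δ i).app m w := by
  have hz : j ∉ vertices z := by
    rw [← succAbove_mem_vertices_δ_iff (j := i.castSucc), h,
      Fin.succAbove_castSucc_of_le _ _ hij, ← mem_range_δ_iff]
    exact ⟨y, rfl⟩
  obtain ⟨w, rfl⟩ := mem_range_δ_iff.2 hz
  have hinj : Function.Injective ((SSet.stdSimplex.{u}.δ j.succ).app m) :=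
    (mono_iff_injective _).1 inferInstance
  refine ⟨w, rfl, hinj (h.symm.trans ?_)⟩
  exact ConcreteCategory.congr_hom (NatTrans.congr_app (SSet.stdSimplex.δ_comp_δ hij) m).symm w

theorem vertices_δ_mem_hornFaces_iff {k : Fin (N + 2)} (hk : k ≠ 0) {m : SimplexCategoryᵒᵖ}
    {z : (Δ[N] : SSet.{u}).obj m} :
    vertices ((SSet.stdSimplex.δ k).app m z) ∈ hornFaces {0, k} ↔
      z ∈ (SSet.horn N 0).obj m := by
  rw [mem_horn_iff_exists_notMem_vertices]
  refine ⟨fun ⟨j, hj, hjz⟩ ↦ ?_, fun ⟨j, hj, hjz⟩ ↦ ⟨k.succAbove j, ?_, ?_⟩⟩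
  · obtain ⟨j, rfl⟩ := Fin.exists_succAbove_eq (x := j) (y := k) fun h ↦ hj (by simp [h])
    refine ⟨j, ?_, mt succAbove_mem_vertices_δ_iff.2 hjz⟩
    rintro rfl
    exact hj (by simp [Fin.succAbove_ne_zero_zero hk])
  · simp [Fin.succAbove_ne, Fin.succAbove_ne_zero hk hj]
  · exact mt succAbove_mem_vertices_δ_iff.1 hjz

end Vertices

section Duplication

variable {X : ScaledSSet.{u}} {n : ℕ} {i : Fin (n + 2)} {h : Δ[n + 2] ⟶ X.toSSet}

/-- The triangles of `Δ[n + 4]` whose first two vertices are `i + 1` and `i + 2`. -/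
def duplicateTriangles (i : Fin (n + 2)) : Set ((Δ[n + 4] : SSet.{u}) _⦋2⦌) :=
  {τ | τ 0 = i.succ.castSucc.castSucc ∧ τ 1 = i.succ.succ.castSucc}

theorem σ_apply_mem_thin_of_duplicateTriangles
    (hthin : ∀ τ : (Δ[n + 2] : SSet.{u}) _⦋2⦌, τ 0 = i.castSucc → τ 1 = i.succ →
      h.app (op ⦋2⦌) τ ∈ X.thin) {τ : (Δ[n + 3] : SSet.{u}) _⦋2⦌}
    (hτ : (SSet.stdSimplex.δ (Fin.last (n + 4))).app (op ⦋2⦌) τ ∈ duplicateTriangles i) :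
    (SSet.stdSimplex.σ i.castSucc ≫ h).app (op ⦋2⦌) τ ∈ X.thin := by
  have h₀ : (Fin.last (n + 4)).succAbove (τ 0) = i.succ.castSucc.castSucc := hτ.1
  have h₁ : (Fin.last (n + 4)).succAbove (τ 1) = i.succ.succ.castSucc := hτ.2
  rw [Fin.succAbove_last, Fin.castSucc_inj] at h₀ h₁
  refine hthin _ (?_ : i.castSucc.predAbove (τ 0) = _) (?_ : i.castSucc.predAbove (τ 1) = _)
  · rw [h₀, ← Fin.succ_castSucc, Fin.predAbove_succ_self]
  · rw [h₁, Fin.predAbove_succ_of_le]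
    exact Fin.castSucc_lt_succ.le

theorem exists_desc_duplicate {F : LowerSet (Finset (Fin (n + 5)))}
    (hF : omitting (Fin.last (n + 4)) ≤ F)
    (hF' : F ≤ omitting (Fin.last (n + 4)) ⊔ omitting i.succ.castSucc.castSucc)
    (f : ((faceComplex F).preimage (SSet.stdSimplex.δ i.succ.castSucc.castSucc) : SSet.{u}) ⟶
      X.toSSet)
    (hf : ∀ m w hw, f.app m ⟨(SSet.stdSimplex.δ (Fin.last (n + 3))).app m w, hw⟩ = h.app m w)
    (hthin : ∀ τ : (Δ[n + 2] : SSet.{u}) _⦋2⦌, τ 0 = i.castSucc → τ 1 = i.succ →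
      h.app (op ⦋2⦌) τ ∈ X.thin) :
    ∃ φ : (faceComplex F : SSet.{u}) ⟶ X.toSSet,
      (∀ m w hw, φ.app m ⟨(SSet.stdSimplex.δ i.succ.castSucc.castSucc).app m w, hw⟩ =
        f.app m ⟨w, hw⟩) ∧
      (∀ m y hy, φ.app m ⟨(SSet.stdSimplex.δ (Fin.last (n + 4))).app m y, hy⟩ =
        (SSet.stdSimplex.σ i.castSucc ≫ h).app m y) ∧
      ∀ τ, (faceComplex F).ι.app (op ⦋2⦌) τ ∈ duplicateTriangles i →
        φ.app (op ⦋2⦌) τ ∈ X.thin := by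
  have hlast : SSet.Subcomplex.range (SSet.stdSimplex.δ (Fin.last (n + 4))) ≤
      faceComplex.{u} F := fun m z hz ↦ hF (mem_range_δ_iff.1 hz)
  let a := (faceComplex F).fromPreimage (SSet.stdSimplex.{u}.δ i.succ.castSucc.castSucc)
  let b := SSet.Subcomplex.lift (SSet.stdSimplex.δ (Fin.last (n + 4))) hlast
  have : Mono a := mono_of_mono_fac ((faceComplex F).fromPreimage_ι _)
  have : Mono b := mono_of_mono_fac (SSet.Subcomplex.lift_ι _ hlast)
  have hcover : SSet.Subcomplex.range a ⊔ SSet.Subcomplex.range b = ⊤ := by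
    refine top_le_iff.1 fun m ⟨x, hx⟩ _ ↦ ?_
    obtain hxL | hxk := hF' hx
    · obtain ⟨y, rfl⟩ := mem_range_δ_iff.2 hxL
      exact Or.inr ⟨y, rfl⟩
    · obtain ⟨z, rfl⟩ := mem_range_δ_iff.2 hxk
      exact Or.inl ⟨⟨z, hx⟩, rfl⟩
  obtain ⟨φ, hφa, hφb⟩ := exists_desc_of_range_sup_range_eq_top hcover f
    (SSet.stdSimplex.σ i.castSucc ≫ h) fun m ⟨z, hz⟩ y hzy ↦ by
      obtain ⟨w, rfl, rfl⟩ := exists_of_δ_castSucc_eq_δ_succ (Fin.le_last i.succ.castSucc)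
        (congrArg Subtype.val hzy)
      refine (hf m w hz).trans (congrArg (h.app m) ?_)
      exact (ConcreteCategory.congr_hom (NatTrans.congr_app
        (CosimplicialObject.δ_comp_σ_succ SSet.stdSimplex) m) w).symm
  refine ⟨φ, fun m w hw ↦ ConcreteCategory.congr_hom (NatTrans.congr_app hφa m) ⟨w, hw⟩,
    fun m y _ ↦ ConcreteCategory.congr_hom (NatTrans.congr_app hφb m) y,
    fun ⟨τ, hτF⟩ hτ ↦ ?_⟩
  obtain ⟨τ, rfl⟩ : τ ∈ (SSet.Subcomplex.range _).obj _ := mem_range_δ_iff.2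
    ((hF' hτF).resolve_right fun hk ↦ hk (mem_vertices.2 ⟨0, hτ.1⟩))
  refine Set.mem_of_eq_of_mem ?_ (σ_apply_mem_thin_of_duplicateTriangles hthin hτ)
  exact ConcreteCategory.congr_hom (NatTrans.congr_app hφb _) τ

end Duplication

section Fibrations

/-- The terminal scaled simplicial set. -/
def point : ScaledSSet.{u} where
  toSSet := (Functor.const _).obj PUnit
  thin := Set.univ
  degenerate_subset_thin := Set.subset_univ _

/-- The map to the terminal scaled simplicial set. The ∞-bicategories are the `X` for which
`toPoint X` is a weak **S**-fibration. -/
def toPoint (X : ScaledSSet.{u}) : X ⟶ point where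
  toHom := { app _ := TypeCat.ofHom fun _ ↦ PUnit.unit }
  map_thin _ _ := Set.mem_univ _

theorem hom_point_ext {Y : SSet.{u}} (f g : Y ⟶ point.toSSet) : f = g := by
  ext
  rfl

theorem IsInfinityBicategory.isWeakSFibration_toPoint {X : ScaledSSet.{u}}
    (hX : IsInfinityBicategory X) : IsWeakSFibration (toPoint X) :=
  fun _ _ i hi ↦ ⟨fun {f _} _ ↦
    let ⟨l, hl⟩ := hX i hi f
    ⟨⟨⟨l, hl, Hom.ext (hom_point_ext _ _)⟩⟩⟩⟩

theorem IsWeakSFibration.rlp_innerHornInclusions {X S : ScaledSSet.{u}} {p : X ⟶ S}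
    (hp : IsWeakSFibration p) : innerHornInclusions.rlp p :=
  fun _ _ i hi ↦ hp i (innerHornInclusions_le_scaledAnodyne i hi)

end Fibrations

section ExtendDuplicate

variable {X : ScaledSSet.{u}} {n : ℕ} {i : Fin (n + 2)} {h : Δ[n + 2] ⟶ X.toSSet}

theorem exists_extension_duplicate (hX : innerHornInclusions.rlp (toPoint X))
    (hthin : ∀ τ : (Δ[n + 2] : SSet.{u}) _⦋2⦌, τ 0 = i.castSucc → τ 1 = i.succ →
      h.app (op ⦋2⦌) τ ∈ X.thin)
    (g : Δ[n + 3] ⟶ X.toSSet) (hg : SSet.stdSimplex.δ (Fin.last (n + 3)) ≫ g = h) :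
    ∃ z : Δ[n + 4] ⟶ X.toSSet, SSet.stdSimplex.δ i.succ.castSucc.castSucc ≫ z = g ∧
      SSet.stdSimplex.δ (Fin.last (n + 4)) ≫ z = SSet.stdSimplex.σ i.castSucc ≫ h ∧
      ∀ τ ∈ duplicateTriangles i, z.app (op ⦋2⦌) τ ∈ X.thin := by
  have hmatched := isInnerMatched_omitting_top.{u} (k := i.succ.castSucc.castSucc)
    (k' := i.succ.succ.castSucc) rfl (Fin.castSucc_lt_last _)
  obtain ⟨φ, hφk, hφL, hφT⟩ := exists_desc_duplicate le_sup_left le_rfl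
    (SSet.Subcomplex.ι _ ≫ g) (by rintro m w -; rw [← hg]; rfl) hthin
  obtain ⟨z, rfl, -, hzT⟩ := hasLiftingProperty_inducedMap_iff.1
    (hasLiftingProperty_subcomplexInclusion (hmatched.hasLiftingProperty hX le_top)) φ
    { app _ := TypeCat.ofHom fun _ ↦ PUnit.unit } (hom_point_ext _ _) hφT fun _ _ ↦ Set.mem_univ _
  refine ⟨z, ?_, ?_, hzT⟩
  · ext m w
    exact hφk m w (Or.inr (mem_range_δ_iff.1 ⟨w, rfl⟩))
  · ext m y
    exact hφL m y (Or.inl (mem_range_δ_iff.1 ⟨y, rfl⟩))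

end ExtendDuplicate

section LiftDuplicate

variable {X S : ScaledSSet.{u}} {p : X ⟶ S} {n : ℕ} {i : Fin (n + 2)} {h : Δ[n + 2] ⟶ X.toSSet}

theorem omitting_last_sup_le_hornFaces_triple {N : ℕ} {k k' : Fin (N + 1)} (h : k < Fin.last N)
    (h' : k' < Fin.last N) :
    omitting (Fin.last N) ⊔ omitting k ⊓ hornFaces {0, k} ≤
      hornFaces {0, k, k'} ⊔ omitting k ⊓ omitting k' := by
  rintro t (ht | ⟨hk, j, hj, hjt⟩)
  · refine Or.inl ⟨Fin.last N, ?_, ht⟩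
    simp only [Finset.mem_insert, Finset.mem_singleton]
    lia
  · by_cases hjk' : j = k'
    · exact Or.inr ⟨hk, fun h ↦ hjt (hjk' ▸ h)⟩
    · exact Or.inl ⟨j, by grind, hjt⟩

theorem preimage_δ_le_horn {N : ℕ} {k : Fin (N + 2)} (hk : k ≠ 0) (hk' : k < Fin.last (N + 1)) :
    (faceComplex (omitting (Fin.last (N + 1)) ⊔ omitting k ⊓ hornFaces {0, k})).preimage
      (SSet.stdSimplex.{u}.δ k) ≤ Λ[N, 0] := by
  rintro m z (hz | ⟨-, hz⟩)
  · refine (vertices_δ_mem_hornFaces_iff hk).1 ⟨Fin.last (N + 1), ?_, hz⟩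
    simp only [Finset.mem_insert, Finset.mem_singleton]
    lia
  · exact (vertices_δ_mem_hornFaces_iff hk).1 hz

theorem exists_lift_hornFaces_triple (hp : innerHornInclusions.rlp p)
    (hthin : ∀ τ : (Δ[n + 2] : SSet.{u}) _⦋2⦌, τ 0 = i.castSucc → τ 1 = i.succ →
      h.app (op ⦋2⦌) τ ∈ X.thin)
    {f : (Λ[n + 3, 0] : SSet.{u}) ⟶ X.toSSet} {z : Δ[n + 4] ⟶ S.toSSet}
    (hfz : f ≫ p.toHom = Λ[n + 3, 0].ι ≫ SSet.stdSimplex.δ i.succ.castSucc.castSucc ≫ z)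
    (hf : SSet.horn.ι 0 (Fin.last (n + 3)) Fin.last_pos.ne' ≫ f = h)
    (hz : SSet.stdSimplex.δ (Fin.last (n + 4)) ≫ z =
      SSet.stdSimplex.σ i.castSucc ≫ h ≫ p.toHom)
    (hzT : ∀ τ ∈ duplicateTriangles i, z.app (op ⦋2⦌) τ ∈ S.thin) :
    ∃ ψ : (faceComplex (hornFaces {0, i.succ.castSucc.castSucc, i.succ.succ.castSucc} ⊔
        omitting i.succ.castSucc.castSucc ⊓ omitting i.succ.succ.castSucc) : SSet.{u}) ⟶ X.toSSet,
      ψ ≫ p.toHom = (faceComplex _).ι ≫ z ∧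
      (∀ m w hw hw', ψ.app m ⟨(SSet.stdSimplex.δ i.succ.castSucc.castSucc).app m w, hw'⟩ =
        f.app m ⟨w, hw⟩) ∧
      (∀ m y hy, ψ.app m ⟨(SSet.stdSimplex.δ (Fin.last (n + 4))).app m y, hy⟩ =
        (SSet.stdSimplex.σ i.castSucc ≫ h).app m y) := by
  have hk : i.succ.castSucc.castSucc ≠ 0 := Fin.ne_of_val_ne (Nat.succ_ne_zero _)
  have hkL : i.succ.castSucc.castSucc < Fin.last (n + 4) := Fin.castSucc_lt_last _
  have hk'L : i.succ.succ.castSucc < Fin.last (n + 4) := Fin.castSucc_lt_last _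
  obtain ⟨φ, hφk, hφL, hφT⟩ := exists_desc_duplicate le_sup_left (sup_le_sup_left inf_le_left _)
    (SSet.Subcomplex.homOfLE (preimage_δ_le_horn.{u} hk hkL) ≫ f)
    (fun m w _ ↦ ConcreteCategory.congr_hom (NatTrans.congr_app hf m) w) hthin
  have hφz : φ ≫ p.toHom = SSet.Subcomplex.ι _ ≫ z := by
    ext m ⟨x, hx⟩
    by_cases hxL : Fin.last (n + 4) ∈ vertices x
    · obtain ⟨w, rfl⟩ := mem_range_δ_iff.2 (hx.resolve_left fun h ↦ h hxL).1
      refine (congrArg (p.toHom.app m) (hφk m w hx)).trans ?_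
      exact ConcreteCategory.congr_hom (NatTrans.congr_app hfz m) ⟨w, _⟩
    · obtain ⟨y, rfl⟩ := mem_range_δ_iff.2 hxL
      refine (congrArg (p.toHom.app m) (hφL m y hx)).trans ?_
      exact (ConcreteCategory.congr_hom (NatTrans.congr_app hz m) y).symm
  obtain ⟨ψ, hψφ, hψz, -⟩ := hasLiftingProperty_inducedMap_iff.1
    ((isInnerMatched_hornFaces_pair rfl hk'L).hasLiftingProperty hp
      (omitting_last_sup_le_hornFaces_triple hkL hk'L)) φ ((faceComplex _).ι ≫ z) hφz hφT
      fun τ hτ ↦ hzT _ hτ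
  have hψ : ∀ m x hx, ψ.app m ⟨x, omitting_last_sup_le_hornFaces_triple hkL hk'L hx⟩ =
      φ.app m ⟨x, hx⟩ :=
    fun m x hx ↦ ConcreteCategory.congr_hom (NatTrans.congr_app hψφ m) ⟨x, hx⟩
  refine ⟨ψ, hψz, fun m w hw _ ↦ ?_, fun m y _ ↦ ?_⟩
  · exact (hψ m _ (Or.inr ⟨mem_range_δ_iff.1 ⟨w, rfl⟩,
      (vertices_δ_mem_hornFaces_iff hk).2 hw⟩)).trans (hφk m w _)
  · exact (hψ m _ (Or.inl (mem_range_δ_iff.1 ⟨y, rfl⟩))).trans (hφL m y _)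

theorem mem_degenerate_of_apply_eq {N m : ℕ} {τ : (Δ[N] : SSet.{u}) _⦋m⦌} {i j : Fin (m + 1)}
    (hij : i < j) (h : τ i = τ j) : τ ∈ (Δ[N] : SSet.{u}).degenerate m := by
  by_contra hτ
  exact ((SSet.stdSimplex.mem_nonDegenerate_iff_strictMono τ).1 hτ hij).ne h

theorem last_notMem_vertices {N : ℕ} {τ : (Δ[N] : SSet.{u}) _⦋2⦌} (h : τ 2 < Fin.last N) :
    Fin.last N ∉ vertices τ := fun hτ ↦ by
  obtain ⟨j, hj⟩ := mem_vertices.1 hτ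
  exact h.not_ge (hj ▸ (SSet.stdSimplex.asOrderHom τ).monotone (Fin.le_last j))

theorem exists_lift_of_hornFaces_pair (hp : innerHornInclusions.rlp p) (hi : i ≠ 0)
    {φ : (faceComplex (hornFaces {0, i.succ.castSucc.castSucc}) : SSet.{u}) ⟶ X.toSSet}
    {z : Δ[n + 4] ⟶ S.toSSet} (hφz : φ ≫ p.toHom = (faceComplex _).ι ≫ z)
    (hφ : ∀ m y hy, φ.app m ⟨(SSet.stdSimplex.δ (Fin.last (n + 4))).app m y, hy⟩ =
        (SSet.stdSimplex.σ i.castSucc ≫ h).app m y) :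
    ∃ l : Δ[n + 4] ⟶ X.toSSet, (faceComplex _).ι ≫ l = φ ∧ l ≫ p.toHom = z := by
  have hmatched := isInnerMatched_hornFaces_top.{u} (i := i.castSucc.castSucc.castSucc)
    (k := i.succ.castSucc.castSucc) (k' := i.succ.succ.castSucc) (by simpa using hi) rfl rfl
  have hthin : ∀ τ : (Δ[n + 4] : SSet.{u}) _⦋2⦌, τ 0 = i.castSucc.castSucc.castSucc ∧
      τ 1 = i.succ.castSucc.castSucc ∧ τ 2 = i.succ.succ.castSucc →
        ∃ hτ, φ.app (op ⦋2⦌) ⟨τ, hτ⟩ ∈ X.thin := by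
    rintro τ ⟨h₀, h₁, h₂⟩
    have hτL : Fin.last (n + 4) ∉ vertices τ :=
      last_notMem_vertices (h₂ ▸ Fin.castSucc_lt_last _)
    obtain ⟨τ, rfl⟩ := mem_range_δ_iff.2 hτL
    replace h₀ : (Fin.last (n + 4)).succAbove (τ 0) = _ := h₀
    replace h₁ : (Fin.last (n + 4)).succAbove (τ 1) = _ := h₁
    rw [Fin.succAbove_last, Fin.castSucc_inj] at h₀ h₁
    refine ⟨⟨_, ?_, hτL⟩, Set.mem_of_eq_of_mem (hφ _ τ _) <| X.degenerate_subset_thin <|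
      SSet.degenerate_le_preimage h 2 (mem_degenerate_of_apply_eq Fin.zero_lt_one ?_)⟩
    · rw [Finset.mem_insert, Finset.mem_singleton, not_or]
      exact ⟨Fin.last_pos.ne', (Fin.castSucc_lt_last _).ne'⟩
    · change i.castSucc.predAbove (τ 0) = i.castSucc.predAbove (τ 1)
      rw [h₀, h₁, ← Fin.succ_castSucc i, Fin.predAbove_castSucc_self,
        Fin.predAbove_succ_self]
  obtain ⟨l, hl, hl', -⟩ := hasLiftingProperty_inducedMap_iff.1
    (hasLiftingProperty_subcomplexInclusion (hmatched.hasLiftingProperty hp le_top)) φ z hφz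
      (fun τ hτ ↦ (hthin τ.1 hτ).2) fun τ hτ ↦ by
        obtain ⟨hτ', hτX⟩ := hthin τ hτ
        exact Set.mem_of_eq_of_mem
          (ConcreteCategory.congr_hom (NatTrans.congr_app hφz _) ⟨τ, hτ'⟩).symm
          (p.map_thin _ hτX)
  exact ⟨l, hl, hl'⟩

end LiftDuplicate

section FillsOuterHorns

/-- The lifting problems for `Λ[n + 3, 0] ⟶ Δ[n + 3]` against `p` whose horn restricts to `h` on
the last face and to `σ` on the triangle `{0, 1, n + 3}` have solutions. A triangle is coCartesian
when this holds for all `n` and `h`, and fixing `h` allows for varying one face at a time. -/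
def FillsOuterHorns {X S : SSet.{u}} (p : X ⟶ S) {n : ℕ} (h : Δ[n + 2] ⟶ X) (σ : X _⦋2⦌) : Prop :=
  ∀ (f : (Λ[n + 3, 0] : SSet.{u}) ⟶ X) (g : Δ[n + 3] ⟶ S), f ≫ p = Λ[n + 3, 0].ι ≫ g →
    SSet.horn.ι 0 (Fin.last (n + 3)) Fin.last_pos.ne' ≫ f = h →
      f.app (op ⦋2⦌) (SSet.hornTriangle n) = σ →
        ∃ l : Δ[n + 3] ⟶ X, Λ[n + 3, 0].ι ≫ l = f ∧ l ≫ p = g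

theorem isCoCartesianTriangle_iff_fillsOuterHorns {X S : SSet.{u}} {p : X ⟶ S} {σ : X _⦋2⦌} :
    SSet.IsCoCartesianTriangle p σ ↔
      ∀ (n : ℕ) (h : Δ[n + 2] ⟶ X), FillsOuterHorns p h σ :=
  ⟨fun H n _ f g hfg _ hσ ↦ H n f g hfg hσ, fun H n f g hfg hσ ↦ H n _ f g hfg rfl hσ⟩

theorem δ_app_outerTriangle {n : ℕ} {j : Fin (n + 5)} (hj : 1 < j) (hj' : j < Fin.last (n + 4)) :
    (SSet.stdSimplex.δ j).app (op ⦋2⦌) (SSet.outerTriangle.{u} n) =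
      SSet.outerTriangle (n + 1) := by
  ext k : 1
  fin_cases k
  · exact Fin.succAbove_of_castSucc_lt j 0 (Fin.zero_lt_one.trans hj)
  · exact Fin.succAbove_of_castSucc_lt j 1 hj
  · exact (Fin.succAbove_of_le_castSucc j (Fin.last (n + 3)) (Fin.le_castSucc_iff.2 hj')).trans
      (Fin.succ_last _)

section Faces

variable {N : ℕ} {k k' : Fin (N + 2)}

theorem preimage_δ_faceComplex_hornFaces_triple (hk : k ≠ 0) (hk' : k' ≠ 0) (hkk' : k ≠ k') :
    (faceComplex (hornFaces {0, k, k'} ⊔ omitting k ⊓ omitting k')).preimage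
      (SSet.stdSimplex.{u}.δ k') = Λ[N, 0] := by
  ext m z
  rw [← vertices_δ_mem_hornFaces_iff hk']
  have hz : k' ∉ vertices ((SSet.stdSimplex.δ k').app m z) := mem_range_δ_iff.1 ⟨z, rfl⟩
  refine ⟨?_, fun ⟨j, hj, hjz⟩ ↦ ?_⟩
  · rintro (⟨j, hj, hjz⟩ | ⟨hkz, -⟩)
    · exact ⟨j, by grind, hjz⟩
    · exact ⟨k, by grind, hkz⟩
  · by_cases hjk : j = k
    · exact Or.inr ⟨fun h ↦ hjz (hjk ▸ h), hz⟩
    · exact Or.inl ⟨j, by grind, hjz⟩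

theorem faceComplex_hornFaces_triple_sup_range_δ (hk' : k' ≠ 0) (hkk' : k ≠ k') :
    faceComplex.{u} (hornFaces {0, k, k'} ⊔ omitting k ⊓ omitting k') ⊔
      SSet.Subcomplex.range (SSet.stdSimplex.δ k') = faceComplex (hornFaces {0, k}) := by
  ext m z
  have hk'mem : k' ∉ ({0, k} : Finset (Fin (N + 2))) := by grind
  refine ⟨?_, fun ⟨j, hj, hjz⟩ ↦ ?_⟩
  · rintro ((⟨j, hj, hjz⟩ | ⟨-, hz⟩) | hz)
    · exact ⟨j, by grind, hjz⟩
    · exact ⟨k', hk'mem, hz⟩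
    · exact ⟨k', hk'mem, mem_range_δ_iff.1 hz⟩
  · by_cases hjk' : j = k'
    · exact Or.inr (mem_range_δ_iff.2 fun h ↦ hjz (hjk' ▸ h))
    · exact Or.inl (Or.inl ⟨j, by grind, hjz⟩)

end Faces

variable {X S : ScaledSSet.{u}} {p : X ⟶ S} {n : ℕ} {i : Fin (n + 2)} {h : Δ[n + 2] ⟶ X.toSSet}
  {σ : X.toSSet _⦋2⦌}

theorem exists_lift_hornFaces_pair_of_fillsOuterHorns
    (hfill : FillsOuterHorns p.toHom
      (SSet.stdSimplex.δ i.succ.succ ≫ SSet.stdSimplex.σ i.castSucc ≫ h) σ)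
    {ψ : (faceComplex (hornFaces {0, i.succ.castSucc.castSucc, i.succ.succ.castSucc} ⊔
        omitting i.succ.castSucc.castSucc ⊓ omitting i.succ.succ.castSucc) : SSet.{u}) ⟶ X.toSSet}
    {z : Δ[n + 4] ⟶ S.toSSet} (hψz : ψ ≫ p.toHom = (faceComplex _).ι ≫ z)
    (hψL : ∀ m y hy, ψ.app m ⟨(SSet.stdSimplex.δ (Fin.last (n + 4))).app m y, hy⟩ =
        (SSet.stdSimplex.σ i.castSucc ≫ h).app m y)
    (hψσ : ∀ hτ, ψ.app (op ⦋2⦌) ⟨SSet.outerTriangle (n + 1), hτ⟩ = σ) :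
    ∃ φ : (faceComplex (hornFaces {0, i.succ.castSucc.castSucc}) : SSet.{u}) ⟶ X.toSSet,
      (∀ m x hx hx', φ.app m ⟨x, hx⟩ = ψ.app m ⟨x, hx'⟩) ∧
        φ ≫ p.toHom = (faceComplex _).ι ≫ z := by
  have hk : i.succ.castSucc.castSucc ≠ 0 := Fin.ne_of_val_ne (Nat.succ_ne_zero _)
  have hk' : i.succ.succ.castSucc ≠ 0 := Fin.ne_of_val_ne (Nat.succ_ne_zero _)
  have hkk' : i.succ.castSucc.castSucc ≠ i.succ.succ.castSucc :=
    Fin.ne_of_val_ne (Nat.lt_succ_self _).ne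
  have hpre := preimage_δ_faceComplex_hornFaces_triple.{u} hk hk' hkk'
  have hB := faceComplex_hornFaces_triple_sup_range_δ.{u} hk' hkk'
  let f := SSet.Subcomplex.homOfLE hpre.ge ≫ SSet.Subcomplex.fromPreimage _ _ ≫ ψ
  have hf : SSet.horn.ι 0 (Fin.last (n + 3)) Fin.last_pos.ne' ≫ f =
      SSet.stdSimplex.δ i.succ.succ ≫ SSet.stdSimplex.σ i.castSucc ≫ h := by
    ext m w
    have hw := ConcreteCategory.congr_hom (NatTrans.congr_app
      (SSet.stdSimplex.{u}.δ_comp_δ (Fin.le_last i.succ.succ)) m) w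
    exact (congrArg (ψ.app m) (Subtype.ext hw.symm)).trans (hψL m _
      (Set.mem_of_eq_of_mem hw (hpre.ge m ((SSet.horn.ι 0 _ Fin.last_pos.ne').app m w).2)))
  have hfσ : f.app _ (SSet.hornTriangle n) = σ := by
    have hτ := δ_app_outerTriangle.{u} (j := i.succ.succ.castSucc) (Fin.lt_def.2 (by simp))
      (Fin.castSucc_lt_last _)
    exact (congrArg (ψ.app _) (Subtype.ext hτ)).trans
      (hψσ (Set.mem_of_eq_of_mem hτ.symm (hpre.ge _ (SSet.hornTriangle n).2)))
  obtain ⟨l, hl, hlz⟩ := hfill f (SSet.stdSimplex.δ i.succ.succ.castSucc ≫ z)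
    (by simp only [f, Category.assoc, hψz]; rfl) hf hfσ
  have hle := le_sup_left.trans_eq hB
  obtain ⟨φ, hφψ, hφl⟩ := exists_desc_of_sup_range_eq hle hB ψ l (by
    ext m ⟨y, hy⟩
    exact ConcreteCategory.congr_hom (NatTrans.congr_app hl m) ⟨y, hpre.le m hy⟩)
  refine ⟨φ, fun m x _ hx ↦ ConcreteCategory.congr_hom (NatTrans.congr_app hφψ m) ⟨x, hx⟩,
    hom_ext_of_range_sup_range_eq_top (range_homOfLE_sup_range_lift hle hB) ?_ ?_⟩
  · rw [← Category.assoc, hφψ, hψz]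
    rfl
  · rw [← Category.assoc, hφl, hlz]
    rfl

theorem FillsOuterHorns.of_duplicate (hp : innerHornInclusions.rlp p)
    (hS : innerHornInclusions.rlp (toPoint S)) (hi : i ≠ 0)
    (hthin : ∀ τ : (Δ[n + 2] : SSet.{u}) _⦋2⦌, τ 0 = i.castSucc → τ 1 = i.succ →
      h.app (op ⦋2⦌) τ ∈ X.thin)
    (hfill : FillsOuterHorns p.toHom
      (SSet.stdSimplex.δ i.succ.succ ≫ SSet.stdSimplex.σ i.castSucc ≫ h) σ) :
    FillsOuterHorns p.toHom h σ := by
  intro f g hfg hf hσ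
  obtain ⟨z, rfl, hzL, hzT⟩ := exists_extension_duplicate (h := h ≫ p.toHom) hS
    (fun τ h₀ h₁ ↦ p.map_thin _ (hthin τ h₀ h₁)) g (by
      rw [← hf, Category.assoc, hfg, SSet.horn.ι_ι_assoc])
  obtain ⟨ψ, hψz, hψf, hψL⟩ := exists_lift_hornFaces_triple hp hthin hfg hf hzL hzT
  have hk : i.succ.castSucc.castSucc ≠ 0 := Fin.ne_of_val_ne (Nat.succ_ne_zero _)
  have hFG := omitting_last_sup_le_hornFaces_triple (Fin.castSucc_lt_last i.succ.castSucc)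
    (Fin.castSucc_lt_last i.succ.succ)
  have hτ := δ_app_outerTriangle.{u} (j := i.succ.castSucc.castSucc)
    (Fin.lt_def.2 (by simpa [Fin.pos_iff_ne_zero] using hi)) (Fin.castSucc_lt_last _)
  obtain ⟨φ, hφψ, hφz⟩ := exists_lift_hornFaces_pair_of_fillsOuterHorns hfill hψz hψL fun hτG ↦
    ((congrArg (ψ.app _) (Subtype.ext hτ.symm)).trans
      (hψf _ _ (SSet.hornTriangle n).2 (Set.mem_of_eq_of_mem hτ hτG))).trans hσ
  obtain ⟨l, hl, rfl⟩ := exists_lift_of_hornFaces_pair (h := h) hp hi hφz fun m y _ ↦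
    (hφψ m _ _ (hFG (Or.inl (mem_range_δ_iff.1 ⟨y, rfl⟩)))).trans (hψL m y _)
  refine ⟨SSet.stdSimplex.δ i.succ.castSucc.castSucc ≫ l, ?_, rfl⟩
  ext m ⟨w, hw⟩
  have hwk : vertices _ ∈ hornFaces _ := (vertices_δ_mem_hornFaces_iff hk).2 hw
  refine (ConcreteCategory.congr_hom (NatTrans.congr_app hl m) ⟨_, hwk⟩).trans ?_
  exact (hφψ m _ _ (hFG (Or.inr ⟨mem_range_δ_iff.1 ⟨w, rfl⟩, hwk⟩))).trans (hψf m w hw _)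

end FillsOuterHorns

section Collapse

theorem predAbove_castSucc_succAbove_succ_succ {n : ℕ} (i : Fin n) (j : Fin (n + 1)) :
    i.castSucc.predAbove (i.succ.succ.succAbove j) = if j = i.succ then i.castSucc else j := by
  obtain hj | rfl | hj := lt_trichotomy j i.succ
  · rw [Fin.succAbove_succ_of_le _ _ hj.le,
      Fin.predAbove_castSucc_of_le _ _ (Fin.le_castSucc_iff.2 hj), if_neg hj.ne]
  · rw [Fin.succAbove_succ_self, ← Fin.succ_castSucc, Fin.predAbove_succ_self, if_pos rfl]
  · rw [Fin.succAbove_succ_of_lt _ _ hj,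
      Fin.predAbove_succ_of_le _ _ ((Fin.castSucc_le_succ i).trans hj.le), if_neg hj.ne']

theorem exists_eq_apply_last_of_succ_le {n : ℕ} {β : Type*} [PartialOrder β]
    (α : Fin (n + 3) →o β) (hα : ¬ ∀ j, 1 ≤ j → α j = α 1) :
    ∃ i : Fin (n + 2), i ≠ 0 ∧ (∀ j, i.succ ≤ j → α j = α (Fin.last _)) ∧
      α i.castSucc < α (Fin.last _) := by
  have h₁ : α (1 : Fin (n + 2)).castSucc < α (Fin.last _) :=
    lt_of_le_of_ne (α.monotone (Fin.le_last _)) fun h ↦ hα fun j hj ↦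
      le_antisymm ((α.monotone (Fin.le_last j)).trans_eq h.symm) (α.monotone hj)
  obtain ⟨i, hi, hmax⟩ := Finite.exists_le_maximal
    (p := fun i : Fin (n + 2) ↦ α i.castSucc < α (Fin.last _)) h₁
  refine ⟨i, (Fin.zero_lt_one.trans_le hi).ne', fun j hj ↦ ?_, hmax.prop⟩
  cases j using Fin.lastCases with
  | last => rfl
  | cast j =>
    exact eq_of_le_of_not_lt (α.monotone (Fin.le_last _))
      (hmax.not_prop_of_gt (Fin.succ_le_castSucc_iff.1 hj))

theorem map_comp_eq_const {X : SSet.{u}} {n : ℕ} {h : Δ[n + 2] ⟶ X} {a : X _⦋0⦌}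
    (ha : h.app (op ⦋1⦌) (SSet.stdSimplex.edge (n + 2) 0 1 (Fin.zero_le _)) =
      SSet.constSimplex X (op ⦋1⦌) a)
    {β : Fin (n + 3) →o Fin (n + 3)} (hβ₀ : β 0 = 0) (hβ₁ : ∀ j, 1 ≤ j → β j = 1) :
    SSet.stdSimplex.map (SimplexCategory.mkHom β) ≫ h = SSet.const a := by
  have hβ : SimplexCategory.mkHom β =
      SimplexCategory.toMk₁ 1 ≫ SimplexCategory.mkOfLe 0 1 (Fin.zero_le _) := by
    ext j : 3
    cases j using Fin.cases with
    | zero => exact hβ₀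
    | succ j => exact hβ₁ _ (Fin.one_le_of_ne_zero (Fin.succ_ne_zero j))
  have hedge : SSet.stdSimplex.map (SimplexCategory.mkOfLe 0 1 (Fin.zero_le _)) ≫ h =
      SSet.const a := by
    apply SSet.yonedaEquiv.injective
    refine Eq.trans (congrArg (h.app _) ?_) ha
    ext k : 1
    fin_cases k <;> rfl
  rw [hβ]
  exact congrArg (SSet.stdSimplex.map (SimplexCategory.toMk₁ 1) ≫ ·) hedge

variable {X S : ScaledSSet.{u}} {p : X ⟶ S} {n : ℕ} {h : Δ[n + 2] ⟶ X.toSSet}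
  {σ : X.toSSet _⦋2⦌}

theorem fillsOuterHorns_map_of_forall (hp : innerHornInclusions.rlp p)
    (hS : innerHornInclusions.rlp (toPoint S))
    (hfill : ∀ β : Fin (n + 3) →o Fin (n + 3), β 0 = 0 → (∀ j, 1 ≤ j → β j = 1) →
      FillsOuterHorns p.toHom (SSet.stdSimplex.map (SimplexCategory.mkHom β) ≫ h) σ)
    (α : Fin (n + 3) →o Fin (n + 3)) (hα₀ : α 0 = 0) (hα₁ : α 1 = 1) :
    FillsOuterHorns p.toHom (SSet.stdSimplex.map (SimplexCategory.mkHom α) ≫ h) σ := by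
  have := DFunLike.finite (Fin (n + 3) →o Fin (n + 3))
  induction α using WellFoundedLT.induction with
  | _ α ih =>
    by_cases hα : ∀ j, 1 ≤ j → α j = α 1
    · exact hfill α hα₀ fun j hj ↦ (hα j hj).trans hα₁
    obtain ⟨i, hi, hlast, hlt⟩ := exists_eq_apply_last_of_succ_le α hα
    refine .of_duplicate hp hS hi (fun τ _ hτ₁ ↦ X.degenerate_subset_thin
      (SSet.degenerate_le_preimage h 2 (mem_degenerate_of_apply_eq (i := 1) (j := 2)
        (by decide) ?_))) ?_
    · have hτ₂ : i.succ ≤ τ 2 := hτ₁ ▸ (SSet.stdSimplex.asOrderHom τ).monotone (by decide)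
      exact (hlast _ hτ₁.ge).trans (hlast _ hτ₂).symm
    · let ε : Fin (n + 3) →o Fin (n + 3) := (SimplexCategory.σ i.castSucc).toOrderHom.comp
        (SimplexCategory.δ i.succ.succ).toOrderHom
      have hε : ∀ j, ε j = if j = i.succ then i.castSucc else j :=
        predAbove_castSucc_succAbove_succ_succ i
      refine ih (α.comp ε) (Pi.lt_def.2 ⟨fun j ↦ α.monotone ?_, i.succ, ?_⟩) ?_ ?_
      · rw [hε]
        split_ifs with hj
        exacts [hj ▸ Fin.castSucc_le_succ i, le_rfl]
      · change α (ε i.succ) < α i.succ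
        rwa [hε, if_pos rfl, hlast _ le_rfl]
      · change α (ε 0) = 0
        rw [hε, if_neg (Fin.succ_ne_zero i).symm, hα₀]
      · change α (ε 1) = 1
        rw [hε, if_neg, hα₁]
        exact fun h ↦ hi (Fin.succ_injective _ h.symm)

theorem FillsOuterHorns.of_const (hp : innerHornInclusions.rlp p)
    (hS : innerHornInclusions.rlp (toPoint S)) {a : X.toSSet _⦋0⦌}
    (hσ : X.toSSet.δ 2 σ = SSet.constSimplex X.toSSet (op ⦋1⦌) a)
    (hfill : FillsOuterHorns p.toHom (SSet.const a : Δ[n + 2] ⟶ X.toSSet) σ) :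
    FillsOuterHorns p.toHom h σ := by
  intro f g hfg hf hfσ
  have hedge : h.app (op ⦋1⦌) (SSet.stdSimplex.edge (n + 2) 0 1 (Fin.zero_le _)) =
      SSet.constSimplex X.toSSet (op ⦋1⦌) a := by
    rw [← hσ, ← hfσ, ← SSet.δ_naturality_apply, ← hf]
    refine congrArg (f.app _) (Subtype.ext ?_)
    ext k : 1
    fin_cases k <;> rfl
  refine fillsOuterHorns_map_of_forall (h := h) hp hS (fun β hβ₀ hβ₁ ↦ ?_) .id rfl rfl f g hfg
    ?_ hfσ
  · rwa [map_comp_eq_const hedge hβ₀ hβ₁]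
  · exact hf.trans ((congrArg (· ≫ h) (SSet.stdSimplex.map_id ⦋n + 2⦌)).trans
      (Category.id_comp h)).symm

end Collapse

section Cones

/-- The base of a cone, as a natural map: restriction along `Δ^n ⟶ Δ^n ⋆ Δ^0`. The mapping space
`X(a, b)` consists of the cones with base constant at `a` and apex `b`. -/
def conesBase (X : SSet.{u}) : SSet.cones X ⟶ X :=
  Functor.whiskerRight (NatTrans.op SSet.joinPointInl) X

/-- The correspondence between maps `Δ^{n+1} = Δ^n ⋆ Δ^0 ⟶ X` and `n`-simplices of `cones X`. -/
def conesHomEquiv {X : SSet.{u}} {n : ℕ} : (Δ[n + 1] ⟶ X) ≃ (Δ[n] ⟶ SSet.cones X) :=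
  SSet.yonedaEquiv.trans (SSet.yonedaEquiv (X := SSet.cones X) (n := ⦋n⦌)).symm

theorem joinPointInl_app_mk (n : ℕ) :
    SSet.joinPointInl.app ⦋n⦌ = SimplexCategory.δ (Fin.last (n + 1)) := by
  ext i : 3
  exact (Fin.succAbove_last_apply i).symm

theorem joinPoint_map_δ {n : ℕ} (j : Fin (n + 2)) :
    SSet.joinPoint.map (SimplexCategory.δ j) = SimplexCategory.δ j.castSucc := by
  ext i : 3
  induction i using Fin.lastCases with
  | last =>
    exact (SSet.joinPointHom_last _).trans
      (Fin.succAbove_ne_last_last (Fin.castSucc_ne_last j)).symm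
  | cast i => exact (SSet.joinPointHom_castSucc _ i).trans (Fin.castSucc_succAbove_castSucc).symm

variable {X Y : SSet.{u}} {n : ℕ}

theorem conesHomEquiv_comp (G : Δ[n + 1] ⟶ X) (q : X ⟶ Y) :
    conesHomEquiv (G ≫ q) = conesHomEquiv G ≫ SSet.conesMap q :=
  (SSet.yonedaEquiv_symm_comp (X := SSet.cones X) (n := ⦋n⦌) (SSet.yonedaEquiv G : X _⦋n + 1⦌)
    (SSet.conesMap q)).symm

theorem conesHomEquiv_δ_castSucc_comp (j : Fin (n + 2)) (G : Δ[n + 2] ⟶ X) :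
    conesHomEquiv (SSet.stdSimplex.δ j.castSucc ≫ G) = SSet.stdSimplex.δ j ≫ conesHomEquiv G := by
  refine Eq.trans (congrArg SSet.yonedaEquiv.symm ?_)
    (SSet.stdSimplex.δ_comp_yonedaEquiv_symm (X := SSet.cones X)
      (SSet.yonedaEquiv G : X _⦋n + 2⦌) j).symm
  refine (SSet.stdSimplex.yonedaEquiv_δ_comp G _).trans ?_
  exact congrArg (fun θ : ⦋n + 1⦌ ⟶ ⦋n + 2⦌ ↦ X.map θ.op (SSet.yonedaEquiv G))
    (joinPoint_map_δ j).symm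

theorem conesHomEquiv_comp_conesBase (G : Δ[n + 1] ⟶ X) :
    conesHomEquiv G ≫ conesBase X = SSet.stdSimplex.δ (Fin.last (n + 1)) ≫ G := by
  refine (SSet.yonedaEquiv_symm_comp (X := SSet.cones X) (n := ⦋n⦌)
    (SSet.yonedaEquiv G : X _⦋n + 1⦌) (conesBase X)).trans ((Equiv.symm_apply_eq _).2 ?_)
  refine Eq.trans ?_ (SSet.stdSimplex.yonedaEquiv_δ_comp G _).symm
  exact congrArg (fun θ : ⦋n⦌ ⟶ ⦋n + 1⦌ ↦ X.map θ.op (SSet.yonedaEquiv G)) (joinPointInl_app_mk n)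

end Cones

section HornCone

variable {X : SSet.{u}} {n : ℕ} {i : Fin (n + 3)}

theorem isCompatible_conesHomEquiv (F : (Λ[n + 3, i.castSucc] : SSet.{u}) ⟶ X) :
    SSet.horn.IsCompatible (i := i) fun j hj ↦ conesHomEquiv
      (SSet.horn.ι i.castSucc j.castSucc ((Fin.castSucc_injective _).ne hj) ≫ F) := by
  intro j k hj hk hjk
  have h := SSet.horn.IsCompatible.of_hom F j.castSucc k.castSucc
    ((Fin.castSucc_injective _).ne hj) ((Fin.castSucc_injective _).ne hk) hjk
  rw [← conesHomEquiv_δ_castSucc_comp, ← conesHomEquiv_δ_castSucc_comp]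
  exact congrArg conesHomEquiv h

/-- The inclusion of the cone `Λ^n_i ⋆ Δ^0` in `Λ^{n+1}_i`, as a map `Λ^n_i ⟶ cones Λ^{n+1}_i`.
Besides this cone, `Λ^{n+1}_i` contains the last face. -/
noncomputable def hornCone (i : Fin (n + 3)) :
    (Λ[n + 2, i] : SSet.{u}) ⟶ SSet.cones (Λ[n + 3, i.castSucc] : SSet.{u}) :=
  (isCompatible_conesHomEquiv (𝟙 _)).desc

theorem horn_ι_comp_hornCone_conesMap {j : Fin (n + 3)} (hj : j ≠ i)
    (F : (Λ[n + 3, i.castSucc] : SSet.{u}) ⟶ X) :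
    SSet.horn.ι i j hj ≫ hornCone i ≫ SSet.conesMap F =
      conesHomEquiv
        (SSet.horn.ι i.castSucc j.castSucc ((Fin.castSucc_injective _).ne hj) ≫ F) := by
  rw [hornCone, SSet.horn.IsCompatible.ι_desc_assoc, Category.comp_id, conesHomEquiv_comp]

theorem hornCone_conesMap_ι_comp (G : Δ[n + 3] ⟶ X) :
    hornCone i ≫ SSet.conesMap (Λ[n + 3, i.castSucc].ι ≫ G) =
      Λ[n + 2, i].ι ≫ conesHomEquiv G := by
  refine SSet.horn.hom_ext' fun j hj ↦ ?_
  rw [horn_ι_comp_hornCone_conesMap, SSet.horn.ι_ι_assoc, SSet.horn.ι_ι_assoc,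
    conesHomEquiv_δ_castSucc_comp]

theorem hornCone_conesMap_comp_conesBase (F : (Λ[n + 3, i.castSucc] : SSet.{u}) ⟶ X) :
    (hornCone i ≫ SSet.conesMap F) ≫ conesBase X = Λ[n + 2, i].ι ≫
      SSet.horn.ι i.castSucc (Fin.last _) (Fin.castSucc_ne_last i).symm ≫ F := by
  refine SSet.horn.hom_ext' fun j hj ↦ ?_
  have h := SSet.horn.IsCompatible.of_hom F j.castSucc (Fin.last _)
    ((Fin.castSucc_injective _).ne hj) (Fin.castSucc_ne_last i).symm (Fin.castSucc_lt_last j)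
  rw [← Category.assoc, horn_ι_comp_hornCone_conesMap, conesHomEquiv_comp_conesBase,
    SSet.horn.ι_ι_assoc]
  exact h

theorem hornCone_conesMap_ext {F F' : (Λ[n + 3, i.castSucc] : SSet.{u}) ⟶ X}
    (hcone : hornCone i ≫ SSet.conesMap F = hornCone i ≫ SSet.conesMap F')
    (hlast : SSet.horn.ι i.castSucc (Fin.last _) (Fin.castSucc_ne_last i).symm ≫ F =
      SSet.horn.ι i.castSucc (Fin.last _) (Fin.castSucc_ne_last i).symm ≫ F') : F = F' := by
  refine SSet.horn.hom_ext' fun j hj ↦ ?_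
  induction j using Fin.lastCases with
  | last => exact hlast
  | cast j =>
    have hji : j ≠ i := fun h ↦ hj (congrArg _ h)
    apply conesHomEquiv.injective
    rw [← horn_ι_comp_hornCone_conesMap hji, hcone, horn_ι_comp_hornCone_conesMap]

theorem exists_hornCone_conesMap_eq (f : (Λ[n + 2, i] : SSet.{u}) ⟶ SSet.cones X)
    (h : Δ[n + 2] ⟶ X) (hfh : f ≫ conesBase X = Λ[n + 2, i].ι ≫ h) :
    ∃ F : (Λ[n + 3, i.castSucc] : SSet.{u}) ⟶ X, hornCone i ≫ SSet.conesMap F = f ∧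
      SSet.horn.ι i.castSucc (Fin.last _) (Fin.castSucc_ne_last i).symm ≫ F = h := by
  let face (j : Fin (n + 4)) : j ≠ i.castSucc → (Δ[n + 2] ⟶ X) :=
    Fin.lastCases (motive := fun j ↦ j ≠ i.castSucc → (Δ[n + 2] ⟶ X)) (fun _ ↦ h)
      (fun j hj ↦ conesHomEquiv.symm (SSet.horn.ι i j (fun hji ↦ hj (congrArg _ hji)) ≫ f)) j
  have hface_last (hj) : face (Fin.last _) hj = h := by simp [face]
  have hface_castSucc (j hj) : conesHomEquiv (face (Fin.castSucc j) hj) =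
      SSet.horn.ι i j (fun hji ↦ hj (congrArg _ hji)) ≫ f := by simp [face]
  clear_value face
  obtain ⟨F, hF⟩ := SSet.horn.IsCompatible.exists_desc (f := face) (by
    intro j k hj hk hjk
    obtain ⟨j, rfl⟩ := j.eq_castSucc_of_ne_last (Fin.ne_last_of_lt hjk)
    induction k using Fin.lastCases with
    | last =>
      rw [hface_last]
      refine (conesHomEquiv_comp_conesBase _).symm.trans ?_
      rw [hface_castSucc, Category.assoc, hfh, SSet.horn.ι_ι_assoc]
      rfl
    | cast k =>
      have hjk' : j < k := hjk
      refine conesHomEquiv.injective <|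
        (conesHomEquiv_δ_castSucc_comp (k.pred (Fin.ne_zero_of_lt hjk')) _).trans <|
          Eq.trans ?_ (conesHomEquiv_δ_castSucc_comp (j.castPred (Fin.ne_last_of_lt hjk')) _).symm
      rw [hface_castSucc, hface_castSucc]
      exact SSet.horn.IsCompatible.of_hom f j k _ _ hjk')
  refine ⟨F, SSet.horn.hom_ext' fun j hj ↦ ?_, (hF _ _).trans (hface_last _)⟩
  rw [horn_ι_comp_hornCone_conesMap, hF, hface_castSucc]

end HornCone

section MappingSpace

variable {X : SSet.{u}} {a b : X _⦋0⦌}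

/-- The apex of a cone, that is, its value at the join point. -/
def coneApex {m : SimplexCategoryᵒᵖ} (x : (SSet.cones X).obj m) : X _⦋0⦌ :=
  X.map (SSet.joinPointInr m.unop).op x

theorem coneApex_map {m m' : SimplexCategoryᵒᵖ} (θ : m ⟶ m') (x : (SSet.cones X).obj m) :
    coneApex ((SSet.cones X).map θ x) = coneApex x := by
  rw [coneApex, coneApex, ← SSet.joinPointInr_comp θ.unop]
  exact SSet.map_op_map_op X _ _ x

theorem coneApex_conesMap {Y : SSet.{u}} (q : X ⟶ Y) {m : SimplexCategoryᵒᵖ}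
    (x : (SSet.cones X).obj m) :
    coneApex ((SSet.conesMap q).app m x) = q.app (op ⦋0⦌) (coneApex x) :=
  SSet.map_op_app q _ x

theorem coneApex_app_stdSimplex {n : ℕ} (φ : Δ[n] ⟶ SSet.cones X) {m m' : SimplexCategoryᵒᵖ}
    (x : Δ[n].obj m) (x' : Δ[n].obj m') : coneApex (φ.app m x) = coneApex (φ.app m' x') := by
  obtain ⟨y, rfl⟩ := SSet.yonedaEquiv.symm.surjective φ
  exact (coneApex_map (SSet.stdSimplex.objEquiv x).op y).trans
    (coneApex_map (SSet.stdSimplex.objEquiv x').op y).symm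

theorem mappingSpace_ι_comp_conesBase :
    (SSet.mappingSpace X a b).ι ≫ conesBase X = SSet.const a := by
  ext m x
  exact x.2.1

theorem exists_comp_mappingSpace_ι_eq {A : SSet.{u}} {φ : A ⟶ SSet.cones X}
    (hbase : φ ≫ conesBase X = SSet.const a) (hapex : ∀ m x, coneApex (φ.app m x) = b) :
    ∃ f : A ⟶ SSet.mappingSpace X a b, f ≫ (SSet.mappingSpace X a b).ι = φ := by
  refine ⟨Subfunctor.lift φ ?_, Subfunctor.lift_ι _ _⟩
  rintro m _ ⟨x, rfl⟩
  exact ⟨ConcreteCategory.congr_hom (NatTrans.congr_app hbase m) x, hapex m x⟩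

theorem mappingSpaceMap_ι {S : SSet.{u}} (p : X ⟶ S) :
    SSet.mappingSpaceMap p a b ≫ (SSet.mappingSpace S _ _).ι =
      (SSet.mappingSpace X a b).ι ≫ SSet.conesMap p :=
  rfl

end MappingSpace

section HornConeZero

variable {n : ℕ}

theorem conesMap_ι_hornCone_app {i : Fin (n + 3)} {m : SimplexCategoryᵒᵖ}
    (x : (Λ[n + 2, i] : SSet.{u}).obj m) :
    (SSet.conesMap Λ[n + 3, i.castSucc].ι).app m ((hornCone i).app m x) =
      (conesHomEquiv (𝟙 Δ[n + 3])).app m x.1 :=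
  ConcreteCategory.congr_hom (NatTrans.congr_app (hornCone_conesMap_ι_comp (𝟙 _)) m) x

theorem conesHomEquiv_id_app_edge :
    (conesHomEquiv (𝟙 (Δ[n + 3] : SSet.{u}))).app (op ⦋1⦌)
      (SSet.stdSimplex.edge (n + 2) 0 1 (Fin.zero_le _)) = SSet.outerTriangle n := by
  refine SSet.stdSimplex.ext _ _ fun k ↦ ?_
  fin_cases k <;> rfl

theorem hornCone_app_hornEdge :
    (hornCone 0).app (op ⦋1⦌) (SSet.hornEdge.{u} n) = SSet.hornTriangle n :=
  Subtype.ext ((conesMap_ι_hornCone_app (SSet.hornEdge n)).trans conesHomEquiv_id_app_edge)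

theorem coneApex_hornCone_app {i : Fin (n + 3)} {m m' : SimplexCategoryᵒᵖ}
    (x : (Λ[n + 2, i] : SSet.{u}).obj m) (x' : (Λ[n + 2, i] : SSet.{u}).obj m') :
    coneApex ((hornCone i).app m x) = coneApex ((hornCone i).app m' x') := by
  have happ {m} (x : (Λ[n + 2, i] : SSet.{u}).obj m) :
      (coneApex ((hornCone i).app m x)).1 =
        coneApex ((conesHomEquiv (𝟙 Δ[n + 3])).app m x.1) :=
    (coneApex_conesMap Λ[n + 3, i.castSucc].ι _).symm.trans
      (congrArg coneApex (conesMap_ι_hornCone_app x))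
  exact Subtype.ext
    ((happ x).trans ((coneApex_app_stdSimplex _ x.1 x'.1).trans (happ x').symm))

variable {X : SSet.{u}} {a b : X _⦋0⦌}

theorem exists_comp_mappingSpace_ι_eq_hornCone {F : (Λ[n + 3, 0] : SSet.{u}) ⟶ X}
    (hlast : SSet.horn.ι 0 (Fin.last (n + 3)) Fin.last_pos.ne' ≫ F = SSet.const a)
    (hapex : SSet.triangleVertex (F.app (op ⦋2⦌) (SSet.hornTriangle n)) 2 = b) :
    ∃ f : (Λ[n + 2, 0] : SSet.{u}) ⟶ SSet.mappingSpace X a b,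
      f ≫ (SSet.mappingSpace X a b).ι = hornCone 0 ≫ SSet.conesMap F := by
  refine exists_comp_mappingSpace_ι_eq ((hornCone_conesMap_comp_conesBase F).trans
    (congrArg (Λ[n + 2, 0].ι ≫ ·) hlast)) fun m x ↦ ?_
  calc coneApex ((SSet.conesMap F).app m ((hornCone 0).app m x))
      = F.app (op ⦋0⦌) (coneApex ((hornCone 0).app m x)) := coneApex_conesMap F _
    _ = F.app (op ⦋0⦌) (coneApex ((hornCone 0).app (op ⦋1⦌) (SSet.hornEdge n))) :=
        congrArg _ (coneApex_hornCone_app x _)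
    _ = coneApex ((SSet.conesMap F).app (op ⦋1⦌) (SSet.hornTriangle n)) :=
        (congrArg (fun y ↦ F.app (op ⦋0⦌) (coneApex y)) hornCone_app_hornEdge).trans
          (coneApex_conesMap F _).symm
    _ = b := hapex

theorem exists_comp_mappingSpace_ι_eq_conesHomEquiv {G : Δ[n + 3] ⟶ X}
    (hlast : SSet.stdSimplex.δ (Fin.last (n + 3)) ≫ G = SSet.const a)
    (hapex : SSet.triangleVertex (G.app (op ⦋2⦌) (SSet.outerTriangle n)) 2 = b) :
    ∃ g : Δ[n + 2] ⟶ SSet.mappingSpace X a b,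
      g ≫ (SSet.mappingSpace X a b).ι = conesHomEquiv G := by
  refine exists_comp_mappingSpace_ι_eq ((conesHomEquiv_comp_conesBase G).trans hlast)
    fun m x ↦ ?_
  calc coneApex ((conesHomEquiv G).app m x)
      = coneApex ((conesHomEquiv (𝟙 _ ≫ G)).app (op ⦋1⦌)
          (SSet.stdSimplex.edge (n + 2) 0 1 (Fin.zero_le _))) := by
        rw [Category.id_comp]
        exact coneApex_app_stdSimplex _ _ _
    _ = coneApex ((SSet.conesMap G).app (op ⦋1⦌) (SSet.outerTriangle n)) := by
        rw [conesHomEquiv_comp]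
        exact congrArg (fun y ↦ coneApex ((SSet.conesMap G).app (op ⦋1⦌) y))
          conesHomEquiv_id_app_edge
    _ = b := hapex

end HornConeZero

section Comparison

variable {X S : SSet.{u}} {p : X ⟶ S} {a b : X _⦋0⦌} {n : ℕ}
  {F : (Λ[n + 3, 0] : SSet.{u}) ⟶ X} {f : (Λ[n + 2, 0] : SSet.{u}) ⟶ SSet.mappingSpace X a b}
  {G : Δ[n + 3] ⟶ X} {g : Δ[n + 2] ⟶ SSet.mappingSpace X a b}

theorem horn_comp_mappingSpaceMap_ι
    (hf : f ≫ (SSet.mappingSpace X a b).ι = hornCone 0 ≫ SSet.conesMap F) :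
    (f ≫ SSet.mappingSpaceMap p a b) ≫ (SSet.mappingSpace S _ _).ι =
      hornCone 0 ≫ SSet.conesMap (F ≫ p) := by
  rw [Category.assoc, mappingSpaceMap_ι, ← Category.assoc, hf]
  rfl

theorem stdSimplex_comp_mappingSpaceMap_ι
    (hg : g ≫ (SSet.mappingSpace X a b).ι = conesHomEquiv G) :
    (g ≫ SSet.mappingSpaceMap p a b) ≫ (SSet.mappingSpace S _ _).ι = conesHomEquiv (G ≫ p) := by
  rw [Category.assoc, mappingSpaceMap_ι, ← Category.assoc, hg, conesHomEquiv_comp]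

theorem horn_ι_comp_mappingSpace_ι
    (hg : g ≫ (SSet.mappingSpace X a b).ι = conesHomEquiv G) :
    (Λ[n + 2, 0].ι ≫ g) ≫ (SSet.mappingSpace X a b).ι =
      hornCone 0 ≫ SSet.conesMap (Λ[n + 3, 0].ι ≫ G) := by
  rw [Category.assoc, hg]
  exact (hornCone_conesMap_ι_comp G).symm

theorem app_hornEdge_val (hf : f ≫ (SSet.mappingSpace X a b).ι = hornCone 0 ≫ SSet.conesMap F) :
    (f.app (op ⦋1⦌) (SSet.hornEdge n)).1 = F.app (op ⦋2⦌) (SSet.hornTriangle n) := by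
  have h := ConcreteCategory.congr_hom (NatTrans.congr_app hf (op ⦋1⦌)) (SSet.hornEdge n)
  exact h.trans (congrArg (F.app (op ⦋2⦌)) hornCone_app_hornEdge)

theorem horn_ι_last_comp_eq_const
    (hg : g ≫ (SSet.mappingSpace X a b).ι = conesHomEquiv G) :
    SSet.horn.ι 0 (Fin.last (n + 3)) Fin.last_pos.ne' ≫ Λ[n + 3, 0].ι ≫ G = SSet.const a := by
  rw [SSet.horn.ι_ι_assoc, ← conesHomEquiv_comp_conesBase, ← hg, Category.assoc,
    mappingSpace_ι_comp_conesBase, SSet.comp_const]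

end Comparison

theorem δ_two_eq_constSimplex {X : SSet.{u}} {a : X _⦋0⦌} {σ : X _⦋2⦌}
    (hσ : SSet.IsLeftDegenerate σ) (ha : SSet.triangleVertex σ 0 = a) :
    X.δ 2 σ = SSet.constSimplex X (op ⦋1⦌) a := by
  refine Eq.trans ?_ (SSet.mappingSpaceEdge σ hσ ha rfl).2.1
  exact congrArg (fun θ : ⦋1⦌ ⟶ ⦋2⦌ ↦ X.map θ.op σ) (joinPointInl_app_mk 1).symm

section CoCartesianEdge

variable {X S : SSet.{u}} {p : X ⟶ S} {a b : X _⦋0⦌} {σ : X _⦋2⦌} {hσ : SSet.IsLeftDegenerate σ}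
  {ha : SSet.triangleVertex σ 0 = a} {hb : SSet.triangleVertex σ 2 = b}

theorem fillsOuterHorns_const_of_isCoCartesianEdge
    (hedge : SSet.IsCoCartesianEdge (SSet.mappingSpaceMap p a b)
      (SSet.mappingSpaceEdge σ hσ ha hb)) (n : ℕ) :
    FillsOuterHorns p (SSet.const a : Δ[n + 2] ⟶ X) σ := by
  intro F G hFG hlast hFσ
  obtain ⟨f, hf⟩ := exists_comp_mappingSpace_ι_eq_hornCone (b := b) hlast
    ((congrArg (SSet.triangleVertex · 2) hFσ).trans hb)
  have hGlast : SSet.stdSimplex.δ (Fin.last (n + 3)) ≫ G = SSet.const (p.app (op ⦋0⦌) a) := by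
    rw [← SSet.horn.ι_ι 0 _ Fin.last_pos.ne', Category.assoc, ← hFG, ← Category.assoc, hlast,
      SSet.const_comp]
  have hGσ : G.app (op ⦋2⦌) (SSet.outerTriangle n) = p.app (op ⦋2⦌) σ :=
    (ConcreteCategory.congr_hom (NatTrans.congr_app hFG (op ⦋2⦌)) (SSet.hornTriangle n)).symm.trans
      (congrArg (p.app (op ⦋2⦌)) hFσ)
  obtain ⟨g, hg⟩ := exists_comp_mappingSpace_ι_eq_conesHomEquiv (b := p.app (op ⦋0⦌) b) hGlast (by
    rw [hGσ, ← hb]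
    exact SSet.map_op_app p _ σ)
  have hfg : f ≫ SSet.mappingSpaceMap p a b = Λ[n + 2, 0].ι ≫ g := by
    rw [← cancel_mono (SSet.mappingSpace S _ _).ι]
    exact (horn_comp_mappingSpaceMap_ι hf).trans
      ((congrArg (hornCone 0 ≫ SSet.conesMap ·) hFG).trans (horn_ι_comp_mappingSpace_ι hg).symm)
  obtain ⟨l, hlf, hlg⟩ := hedge n f g hfg (Subtype.ext ((app_hornEdge_val hf).trans hFσ))
  obtain ⟨L, hL⟩ := conesHomEquiv.surjective (l ≫ (SSet.mappingSpace X a b).ι)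
  refine ⟨L, hornCone_conesMap_ext (i := 0) ?_ ?_, conesHomEquiv.injective ?_⟩
  · exact (horn_ι_comp_mappingSpace_ι hL.symm).symm.trans ((congrArg (· ≫ _) hlf).trans hf)
  · exact (horn_ι_last_comp_eq_const hL.symm).trans hlast.symm
  · rw [← stdSimplex_comp_mappingSpaceMap_ι hL.symm, hlg, hg]

theorem isCoCartesianEdge_of_fillsOuterHorns_const
    (hfill : ∀ n, FillsOuterHorns p (SSet.const a : Δ[n + 2] ⟶ X) σ) :
    SSet.IsCoCartesianEdge (SSet.mappingSpaceMap p a b)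
      (SSet.mappingSpaceEdge σ hσ ha hb) := by
  intro n f g hfg hfσ
  obtain ⟨F, hF, hlast⟩ :=
    exists_hornCone_conesMap_eq (i := 0) (f ≫ (SSet.mappingSpace X a b).ι) (SSet.const a) (by
      rw [Category.assoc, mappingSpace_ι_comp_conesBase]
      rfl)
  obtain ⟨G, hG⟩ := conesHomEquiv.surjective (g ≫ (SSet.mappingSpace S _ _).ι)
  have hFG : F ≫ p = Λ[n + 3, 0].ι ≫ G := by
    refine hornCone_conesMap_ext (i := 0) ?_ ?_
    · exact (horn_comp_mappingSpaceMap_ι hF.symm).symm.trans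
        ((congrArg (· ≫ _) hfg).trans (horn_ι_comp_mappingSpace_ι hG.symm))
    · refine Eq.trans ?_ (horn_ι_last_comp_eq_const hG.symm).symm
      exact (congrArg (· ≫ p) hlast).trans (SSet.const_comp a p)
  have hFσ : F.app (op ⦋2⦌) (SSet.hornTriangle n) = σ :=
    (app_hornEdge_val hF.symm).symm.trans (congrArg Subtype.val hfσ)
  obtain ⟨L, hLF, hLG⟩ := hfill n F G hFG hlast hFσ
  obtain ⟨l, hl⟩ := exists_comp_mappingSpace_ι_eq_conesHomEquiv (G := L) (b := b)
    (by rw [← SSet.horn.ι_ι_assoc 0 _ Fin.last_pos.ne', hLF]; exact hlast) (by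
      refine (congrArg (SSet.triangleVertex · 2) ?_).trans hb
      exact (ConcreteCategory.congr_hom (NatTrans.congr_app hLF (op ⦋2⦌))
        (SSet.hornTriangle n)).trans hFσ)
  refine ⟨l, ?_, ?_⟩
  · rw [← cancel_mono (SSet.mappingSpace X a b).ι]
    exact (horn_ι_comp_mappingSpace_ι hl).trans
      ((congrArg (hornCone 0 ≫ SSet.conesMap ·) hLF).trans hF)
  · rw [← cancel_mono (SSet.mappingSpace S _ _).ι, stdSimplex_comp_mappingSpaceMap_ι hl, hLG, hG]

end CoCartesianEdge

end ScaledSSet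

theorem mainTheorem8_general {X S : ScaledSSet.{u}} (p : X ⟶ S)
    (hp : ScaledSSet.innerHornInclusions.rlp p)
    (hS : ScaledSSet.innerHornInclusions.rlp (ScaledSSet.toPoint S))
    (a b : X.toSSet _⦋0⦌) (σ : X.toSSet _⦋2⦌) (hσ : SSet.IsLeftDegenerate σ)
    (ha : SSet.triangleVertex σ 0 = a) (hb : SSet.triangleVertex σ 2 = b) :
    SSet.IsCoCartesianTriangle p.toHom σ ↔
      SSet.IsCoCartesianEdge (SSet.mappingSpaceMap p.toHom a b)
        (SSet.mappingSpaceEdge σ hσ ha hb) := by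
  rw [ScaledSSet.isCoCartesianTriangle_iff_fillsOuterHorns]
  constructor
  · exact fun hfill ↦ ScaledSSet.isCoCartesianEdge_of_fillsOuterHorns_const fun n ↦ hfill n _
  · intro hedge n h
    exact .of_const hp hS (ScaledSSet.δ_two_eq_constSimplex hσ ha)
      (ScaledSSet.fillsOuterHorns_const_of_isCoCartesianEdge hedge n)

theorem mainTheorem8 {X S : ScaledSSet.{u}}
    (hX : ScaledSSet.IsInfinityBicategory X) (hS : ScaledSSet.IsInfinityBicategory S)
    (p : X ⟶ S) (hp : ScaledSSet.IsWeakSFibration p)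
    (a b : X.toSSet _⦋0⦌) (σ : X.toSSet _⦋2⦌) (hσ : SSet.IsLeftDegenerate σ)
    (ha : SSet.triangleVertex σ 0 = a) (hb : SSet.triangleVertex σ 2 = b) :
    SSet.IsCoCartesianTriangle p.toHom σ ↔
      SSet.IsCoCartesianEdge (SSet.mappingSpaceMap p.toHom a b)
        (SSet.mappingSpaceEdge σ hσ ha hb) :=
  mainTheorem8_general p hp.rlp_innerHornInclusions
    hS.isWeakSFibration_toPoint.rlp_innerHornInclusions a b σ hσ ha hb
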